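/- \textbf{Setting.} Let $a<b$, $M,N\in\mathbb N$, $\mathcal Z=[a,b]^M$, and $\|v\|_1=\sum_i|v(i)|$. On a probability space $(\Omega,\mathscr F,\mathcal P)$ let $(X_t)_{t\ge-1}$ be a time-homogeneous Markov process in $\mathbb R^M$ with stochastic kernel $\mathcal K(\cdot\mid\cdot)$, started from an invariant law $\nu$ of $\mathcal K$, with $X_t\in\mathcal Z$ almost surely for all $t$. It is observed through $(\mathbf y_t)_{t\ge0}$ in $\mathbb R^N$: conditionally on the process $X$, the $\mathbf y_t$ are independent with $\mathbf y_t\sim\mathcal N(\boldsymbol\mu_t(X_t),\mathbf C_t(X_t))$, where $\mathbf C_t=\boldsymbol\Sigma_t+\sigma^2\mathbf I_N$, $\sigma\ge0$, $\boldsymbol\Sigma_t(x)\succ0$ for $x\in\mathcal Z$. Assume, uniformly in $t\in\mathbb N$ and $x\in\mathcal Z$, that $\|\boldsymbol\mu_t(x)\|_2$ and $\lambda_{\max}(\mathbf C_t(x))$ are bounded above, that $\inf_{t,x}\lambda_{\min}(\mathbf C_t(x))>1$, and that all $\boldsymbol\mu_t$ and all entries of all $\boldsymbol\Sigma_t$ are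 Lipschitz on $\mathcal Z$ for the $\ell_1$-norm with a common constant. Let $\mathscr Y_t=\sigma(\mathbf y_0,\dots,\mathbf y_t)$. \textbf{Quantization.} For $L\ge1$ let $L_S=L^M$, partition $[a,b]$ into $L$ intervals of equal length, and let $\Pi_{L_S}$ be the resulting product partition of $\mathcal Z$ into cells $\mathcal Z^1_{L_S},\dots,\mathcal Z^{L_S}_{L_S}$ with centres $\boldsymbol x^1_{L_S},\dots,\boldsymbol x^{L_S}_{L_S}$; let $\mathcal Z_{L_S}(x)$ be the cell containing $x$ and $\mathbf X=[\boldsymbol x^1_{L_S}\cdots\boldsymbol x^{L_S}_{L_S}]$. Let $\mathcal Q_{L_S}(x)$ be the centre of $\mathcal Z_{L_S}(x)$, $X_t^{L_S}=\mathcal Q_{L_S}(X_t)$ (the marginal quantization), and let $\mathcal Q^e_{L_S}(X^{L_S}_t)$ be the $l$-th standard basis vector $\mathbf e_l$ of $\mathbb R^{L_S}$ when $X_t\in\mathcal Z^l_{L_S}$. Let $\boldsymbol P(i,j)=\mathcal P(X_t\in\mathcal Z^i_{L_S}\mid X_{t-1}\in\mathcal Z^j_{L_S})$, which does not depend on $t$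 (only cells $j$ of positive probability matter). \textbf{Conditional regularity.} For a cell $E$ with $\nu(E)>0$ put $\mathcal K(A\mid\in E)=\nu(E)^{-1}\int_E\mathcal K(A\mid\theta)\,\nu(d\theta)$. The state is conditionally regular if at least one of the following holds. (I) There are functions $\delta_n\ge0$, $n\ge1$, uniformly integrable with respect to $\nu$ and with $\delta_n\to0$ $\nu$-a.e., such that for $\nu$-almost all $x$ and all $L\ge1$, $\sup_{A\in\Pi_{L_S}}|\mathcal K(A\mid x)-\mathcal K(A\mid\in\mathcal Z_{L_S}(x))|\le\delta_{L_S}(x)/L_S$. (II) For $\nu$-almost all $x$ the measure $\mathcal K(\cdot\mid x)$ has a (jointly measurable) Lebesgue density $\kappa(\cdot\mid x)$, and there are such functions $\delta_n$ with $\operatorname{ess\,sup}_{v\in\mathbb R^M}|\kappa(v\mid x)-\kappa(v\mid\in\mathcal Z_{L_S}(x))|\le\delta_{L_S}(x)$ for $\nu$-almost all $x$ and all $L\ge1$, where $\kappa(v\mid\in E)=\nu(E)^{-1}\int_E\kappa(v\mid\theta)\,\nu(d\theta)$. \textbf{Filters.} Fix a natural $T<\infty$ and let $\widetilde{\mathcal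 P}$ be a probability measure on $\Omega$ under which, up to time $T$, the process $X$ has the same law as under $\mathcal P$, the $\mathbf y_t$ are i.i.d. $\mathcal N(\mathbf 0,\mathbf I_N)$, and $X$ and $\mathbf y$ are independent. With $\mathsf L_t(x,v)=(\sqrt{2\pi})^N\mathcal N(v;\boldsymbol\mu_t(x),\mathbf C_t(x))$, where $\mathcal N(v;\boldsymbol\mu,\mathbf C)$ is the Gaussian density, put $\Lambda^{L_S}_t=\prod_{i=0}^t\mathsf L_i(X_i^{L_S},\mathbf y_i)$ and $$\mathcal E^{L_S}(X_t\mid\mathscr Y_t)=\frac{\mathbb E_{\widetilde{\mathcal P}}\{X^{L_S}_t\Lambda^{L_S}_t\mid\mathscr Y_t\}}{\mathbb E_{\widetilde{\mathcal P}}\{\Lambda^{L_S}_t\mid\mathscr Y_t\}}.$$ For each $L$ let $(Z^{L_S}_t)_{-1\le t\le T}$ be, under $\widetilde{\mathcal P}$, a Markov chain with values in $\{\mathbf e_1,\dots,\mathbf e_{L_S}\}$ and transition matrix $\boldsymbol P$, independent of $\mathbf y_0,\dots,\mathbf y_T$, put $\Lambda^{Z,L_S}_t=\prod_{i=0}^t\mathsf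 L_i(\mathbf XZ_i^{L_S},\mathbf y_i)$ and $$\widetilde{\mathcal E}^{L_S}(X_t\mid\mathscr Y_t)=\frac{\mathbf X\,\mathbb E_{\widetilde{\mathcal P}}\{Z^{L_S}_t\Lambda^{Z,L_S}_t\mid\mathscr Y_t\}}{\mathbb E_{\widetilde{\mathcal P}}\{\Lambda^{Z,L_S}_t\mid\mathscr Y_t\}}.$$ \textbf{Lemma.} Suppose that the state is conditionally regular. Then for every finite $C\ge1$ there is a measurable set $\widehat\Omega_T\subseteq\Omega$ with $\mathcal P(\widehat\Omega_T)\ge1-(T+1)^{1-CN}\exp(-CN)$ such that, as $L\to\infty$, $$\sup_{0\le t\le T}\ \sup_{\omega\in\widehat\Omega_T}\big\|\mathcal E^{L_S}(X_t\mid\mathscr Y_t)-\mathbb E_{\mathcal P}\{X_t\mid\mathscr Y_t\}\big\|_1(\omega)\longrightarrow0,$$ and such that on the same set $\widehat\Omega_T$, for all chains $Z^{L_S}$ as above whose initial law satisfies $\mathbb E_{\widetilde{\mathcal P}}\{Z^{L_S}_{-1}\}=\mathbb E_{\mathcal P}\{\mathcal Q^e_{L_S}(X^{L_S}_{-1})\}$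 for every $L$, $$\sup_{0\le t\le T}\ \sup_{\omega\in\widehat\Omega_T}\big\|\mathcal E^{L_S}(X_t\mid\mathscr Y_t)-\widetilde{\mathcal E}^{L_S}(X_t\mid\mathscr Y_t)\big\|_1(\omega)\longrightarrow0$$ and $$\sup_{0\le t\le T}\ \sup_{\omega\in\widehat\Omega_T}\big\|\widetilde{\mathcal E}^{L_S}(X_t\mid\mathscr Y_t)-\mathbb E_{\mathcal P}\{X_t\mid\mathscr Y_t\}\big\|_1(\omega)\longrightarrow0.$$ Here conditional expectations are defined up to null sets, and the last two suprema over $\widehat\Omega_T$ disregard a $\mathcal P$-null set, which may depend on the chains $Z^{L_S}$. -/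

import Mathlib

open MeasureTheory ProbabilityTheory Filter Topology
open scoped ENNReal Matrix

namespace GridFilter

noncomputable section

/-! ### Norm, state box, uniform quantization -/

/-- The `ℓ₁`-norm of a real vector. -/
def l1 {ι : Type*} [Fintype ι] (v : ι → ℝ) : ℝ := ∑ i, |v i|

/-- The compact set `[a,b]^M` supporting the state. -/
def box (M : ℕ) (a b : ℝ) : Set (Fin M → ℝ) := Set.Icc (fun _ => a) (fun _ => b)

/-- A uniform partition of `[a,b]` into `L` intervals of equal length. Which of two adjacent
intervals owns their common endpoint is left free. -/
structure IsUniformPartition (a b : ℝ) (L : ℕ+) (I : Fin L → Set ℝ) : Prop where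
  disjoint : Pairwise (fun k l => Disjoint (I k) (I l))
  iUnion_eq : ⋃ l, I l = Set.Icc a b
  Ioo_subset : ∀ l : Fin L,
    Set.Ioo (a + (l : ℝ) * (b - a) / L) (a + ((l : ℝ) + 1) * (b - a) / L) ⊆ I l
  subset_Icc : ∀ l : Fin L,
    I l ⊆ Set.Icc (a + (l : ℝ) * (b - a) / L) (a + ((l : ℝ) + 1) * (b - a) / L)

/-- Cells of the product partition of `[a,b]^M`; there are `L ^ M` of them, indexed by
`Fin M → Fin L`. -/
def cell {M : ℕ} {L : ℕ+} (I : Fin L → Set ℝ) (j : Fin M → Fin L) : Set (Fin M → ℝ) :=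
  {x | ∀ i, x i ∈ I (j i)}

/-- The reconstruction matrix: its columns are the centres of the cells. -/
def recon (M : ℕ) (a b : ℝ) (L : ℕ+) : Matrix (Fin M) (Fin M → Fin L) ℝ :=
  Matrix.of fun i j => a + ((j i : ℝ) + 1 / 2) * (b - a) / L

/-- The quantizer with values in the standard basis: `x` in the cell `j` is sent to the `j`-th
basis vector. (Outside `[a,b]^M`, which the state visits with probability zero, it vanishes.) -/
def basisQuantizer {M : ℕ} {L : ℕ+} (I : Fin L → Set ℝ) (x : Fin M → ℝ) :
    (Fin M → Fin L) → ℝ :=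
  fun j => (cell I j).indicator (fun _ => (1 : ℝ)) x

/-- The quantizer of `[a,b]^M`: a point is sent to the centre of its cell. -/
def quantizer {M : ℕ} (a b : ℝ) {L : ℕ+} (I : Fin L → Set ℝ) (x : Fin M → ℝ) : Fin M → ℝ :=
  recon M a b L *ᵥ basisQuantizer I x

/-! ### The partially observed system

Time of the state is shifted by one: `X 0` is the initial value `X_{-1}`, and `X (t + 1)` is the
state at time `t`, observed through `y t`. The same shift is used for the chain `Z`. -/

/-- Conditional covariance `C_t(x) = S_t(x) + σ² I` of the observations. -/
def obsCov {M N : ℕ} (S : ℕ → (Fin M → ℝ) → Matrix (Fin N) (Fin N) ℝ) (σ : ℝ)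
    (t : ℕ) (x : Fin M → ℝ) : Matrix (Fin N) (Fin N) ℝ :=
  S t x + σ ^ 2 • (1 : Matrix (Fin N) (Fin N) ℝ)

/-- Boundedness and Lipschitz assumptions on the observation model, on the box `[a,b]^M` and
uniformly in time. -/
structure ObsAssumptions {M N : ℕ} (a b : ℝ) (m : ℕ → (Fin M → ℝ) → EuclideanSpace ℝ (Fin N))
    (S : ℕ → (Fin M → ℝ) → Matrix (Fin N) (Fin N) ℝ) (σ : ℝ) : Prop where
  sigma_nonneg : 0 ≤ σ
  posDef : ∀ t, ∀ x ∈ box M a b, (S t x).PosDef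
  /-- the largest eigenvalues of the covariances are bounded -/
  cov_le : ∃ lsup : ℝ, ∀ t, ∀ x ∈ box M a b,
    (lsup • (1 : Matrix (Fin N) (Fin N) ℝ) - obsCov S σ t x).PosSemidef
  /-- the infimum of the smallest eigenvalues of the covariances exceeds one -/
  le_cov : ∃ linf : ℝ, 1 < linf ∧ ∀ t, ∀ x ∈ box M a b,
    (obsCov S σ t x - linf • (1 : Matrix (Fin N) (Fin N) ℝ)).PosSemidef
  mean_le : ∃ msup : ℝ, ∀ t, ∀ x ∈ box M a b, ‖m t x‖ ≤ msup
  mean_lipschitz : ∃ Km : ℝ, ∀ t, ∀ x ∈ box M a b, ∀ x' ∈ box M a b,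
    l1 (fun i => m t x i - m t x' i) ≤ Km * l1 (x - x')
  cov_lipschitz : ∃ KS : ℝ, ∀ t, ∀ x ∈ box M a b, ∀ x' ∈ box M a b, ∀ i j,
    |S t x i j - S t x' i j| ≤ KS * l1 (x - x')

/-- The σ-algebra generated by the states up to and including index `n`. -/
abbrev stateSigma {Ω : Type*} {M : ℕ} (X : ℕ → Ω → Fin M → ℝ) (n : ℕ) : MeasurableSpace Ω :=
  ⨆ k ≤ n, MeasurableSpace.comap (X k) inferInstance

/-- The σ-algebra generated by the observations up to and including time `t`. -/
abbrev obsSigma {Ω : Type*} {N : ℕ} (y : ℕ → Ω → EuclideanSpace ℝ (Fin N)) (t : ℕ) :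
    MeasurableSpace Ω :=
  ⨆ s ≤ t, MeasurableSpace.comap (y s) inferInstance

/-- Under `P`, the state `X` is a stationary Markov process with kernel `K`, almost surely in
`[a,b]^M`, and, conditionally on the whole state process, the observations are independent with
`y t ∼ 𝒩(m_t(X_t), C_t(X_t))`. -/
structure IsPartiallyObserved {Ω : Type*} [MeasurableSpace Ω] {M N : ℕ} (a b : ℝ)
    (m : ℕ → (Fin M → ℝ) → EuclideanSpace ℝ (Fin N))
    (S : ℕ → (Fin M → ℝ) → Matrix (Fin N) (Fin N) ℝ) (σ : ℝ)
    (K : Kernel (Fin M → ℝ) (Fin M → ℝ)) (P : Measure Ω)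
    (X : ℕ → Ω → Fin M → ℝ) (y : ℕ → Ω → EuclideanSpace ℝ (Fin N)) : Prop where
  measurable_state : ∀ n, Measurable (X n)
  measurable_obs : ∀ t, Measurable (y t)
  state_mem : ∀ n, ∀ᵐ ω ∂P, X n ω ∈ box M a b
  invariant : K.Invariant (P.map (X 0))
  markov : ∀ n, ∀ A : Set (Fin M → ℝ), MeasurableSet A →
    P[(X (n + 1) ⁻¹' A).indicator (fun _ => (1 : ℝ)) | stateSigma X n]
      =ᵐ[P] fun ω => (K (X n ω)).real A
  obs_law : ∀ (t : ℕ) (A : Set (ℕ → Fin M → ℝ)) (B : ℕ → Set (EuclideanSpace ℝ (Fin N))),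
    MeasurableSet A → (∀ s, MeasurableSet (B s)) →
    P {ω | (fun n => X n ω) ∈ A ∧ ∀ s ≤ t, y s ω ∈ B s} =
      ∫⁻ ω in {ω | (fun n => X n ω) ∈ A}, ∏ s ∈ Finset.range (t + 1),
        multivariateGaussian (m s (X (s + 1) ω)) (obsCov S σ s (X (s + 1) ω)) (B s) ∂P

/-! ### Conditional regularity -/

/-- The cumulative kernel `K(A | ∈ E)`, for the law `ν` of the state and a cell `E`. -/
def cumKernel {M : ℕ} (K : Kernel (Fin M → ℝ) (Fin M → ℝ)) (ν : Measure (Fin M → ℝ))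
    (A E : Set (Fin M → ℝ)) : ℝ :=
  (∫ θ in E, (K θ).real A ∂ν) / ν.real E

/-- The cumulative kernel density `κ(v | ∈ E)`; here `κ x v` stands for `κ(v | x)`. -/
def cumDensity {M : ℕ} (κ : (Fin M → ℝ) → (Fin M → ℝ) → ℝ) (ν : Measure (Fin M → ℝ))
    (v : Fin M → ℝ) (E : Set (Fin M → ℝ)) : ℝ :=
  (∫ θ in E, κ θ v ∂ν) / ν.real E

/-- A sequence of nonnegative functions, uniformly integrable with respect to `ν` and convergent to
zero `ν`-almost everywhere. -/
structure IsVanishingUI {M : ℕ} (ν : Measure (Fin M → ℝ)) (δ : ℕ+ → (Fin M → ℝ) → ℝ) :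
    Prop where
  nonneg : ∀ n x, 0 ≤ δ n x
  uniformIntegrable : UniformIntegrable δ 1 ν
  tendsto : ∀ᵐ x ∂ν, Tendsto (fun n => δ n x) atTop (𝓝 0)

/-- Conditional regularity of type I. -/
def CRT1 {M : ℕ} (I : (L : ℕ+) → Fin L → Set ℝ) (K : Kernel (Fin M → ℝ) (Fin M → ℝ))
    (ν : Measure (Fin M → ℝ)) : Prop :=
  ∃ δ : ℕ+ → (Fin M → ℝ) → ℝ, IsVanishingUI ν δ ∧
    ∀ᵐ x ∂ν, ∀ (L : ℕ+) (j : Fin M → Fin L), x ∈ cell (I L) j → ∀ i : Fin M → Fin L,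
      |(K x).real (cell (I L) i) - cumKernel K ν (cell (I L) i) (cell (I L) j)|
        ≤ δ (L ^ M) x / ((L ^ M : ℕ+) : ℝ)

/-- Conditional regularity of type II. -/
def CRT2 {M : ℕ} (I : (L : ℕ+) → Fin L → Set ℝ) (K : Kernel (Fin M → ℝ) (Fin M → ℝ))
    (ν : Measure (Fin M → ℝ)) : Prop :=
  ∃ κ : (Fin M → ℝ) → (Fin M → ℝ) → ℝ,
    Measurable (Function.uncurry κ) ∧ (∀ x v, 0 ≤ κ x v) ∧
    (∀ᵐ x ∂ν, K x = volume.withDensity (fun v => ENNReal.ofReal (κ x v))) ∧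
    ∃ δ : ℕ+ → (Fin M → ℝ) → ℝ, IsVanishingUI ν δ ∧
      ∀ᵐ x ∂ν, ∀ (L : ℕ+) (j : Fin M → Fin L), x ∈ cell (I L) j →
        ∀ᵐ v ∂(volume : Measure (Fin M → ℝ)),
          |κ x v - cumDensity κ ν v (cell (I L) j)| ≤ δ (L ^ M) x

/-- The state is conditionally regular if its kernel is so, of type I or of type II. -/
def ConditionallyRegular {M : ℕ} (I : (L : ℕ+) → Fin L → Set ℝ)
    (K : Kernel (Fin M → ℝ) (Fin M → ℝ)) (ν : Measure (Fin M → ℝ)) : Prop :=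
  CRT1 I K ν ∨ CRT2 I K ν

/-! ### Change of measure and filters -/

/-- The measure `Q` is a reference measure for `P` up to the horizon `T`: under `Q` the state process
has the same law as under `P`, the observations are standard Gaussian white noise, and the two
processes are independent. -/
structure IsReferenceMeasure {Ω : Type*} [MeasurableSpace Ω] {M N : ℕ} (T : ℕ)
    (X : ℕ → Ω → Fin M → ℝ) (y : ℕ → Ω → EuclideanSpace ℝ (Fin N)) (P Q : Measure Ω) :
    Prop where
  map_state : Q.map (fun ω (n : Fin (T + 2)) => X n ω) = P.map (fun ω (n : Fin (T + 2)) => X n ω)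
  map_obs : ∀ t ≤ T, Q.map (y t) = stdGaussian (EuclideanSpace ℝ (Fin N))
  iIndep_obs : iIndepFun (fun t : Fin (T + 1) => y t) Q
  indep : IndepFun (fun ω (n : Fin (T + 2)) => X n ω) (fun ω (t : Fin (T + 1)) => y t ω) Q

/-- Density at `v` of the Gaussian law on `ℝ^N` with mean `c` and covariance matrix `C`. -/
def gaussianDensity {N : ℕ} (c : EuclideanSpace ℝ (Fin N)) (C : Matrix (Fin N) (Fin N) ℝ)
    (v : EuclideanSpace ℝ (Fin N)) : ℝ :=
  (√((2 * Real.pi) ^ N * C.det))⁻¹ *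
    Real.exp (-(1 / 2) * ((v - c).ofLp ⬝ᵥ (C⁻¹ *ᵥ (v - c).ofLp)))

/-- The likelihood `L_t(x, v) = (√(2π))^N 𝒩(v; m_t(x), C_t(x))`. -/
def likelihood {M N : ℕ} (m : ℕ → (Fin M → ℝ) → EuclideanSpace ℝ (Fin N))
    (S : ℕ → (Fin M → ℝ) → Matrix (Fin N) (Fin N) ℝ) (σ : ℝ) (t : ℕ) (x : Fin M → ℝ)
    (v : EuclideanSpace ℝ (Fin N)) : ℝ :=
  (√(2 * Real.pi)) ^ N * gaussianDensity (m t x) (obsCov S σ t x) v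

/-- The product `Λ_t` of the likelihoods up to time `t`, along a process `ξ` in the place of the
state. -/
def cumLikelihood {Ω : Type*} {M N : ℕ} (m : ℕ → (Fin M → ℝ) → EuclideanSpace ℝ (Fin N))
    (S : ℕ → (Fin M → ℝ) → Matrix (Fin N) (Fin N) ℝ) (σ : ℝ)
    (y : ℕ → Ω → EuclideanSpace ℝ (Fin N)) (ξ : ℕ → Ω → Fin M → ℝ) (t : ℕ) (ω : Ω) : ℝ :=
  ∏ s ∈ Finset.range (t + 1), likelihood m S σ s (ξ (s + 1) ω) (y s ω)

/-- The MMSE filter `E_P{X_t | 𝒴_t}`. -/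
def trueFilter {Ω : Type*} [MeasurableSpace Ω] {M N : ℕ} (P : Measure Ω)
    (X : ℕ → Ω → Fin M → ℝ) (y : ℕ → Ω → EuclideanSpace ℝ (Fin N)) (t : ℕ) : Ω → Fin M → ℝ :=
  P[X (t + 1) | obsSigma y t]

/-- The marginal quantization of the state. -/
def marginalQuantization {Ω : Type*} {M : ℕ} (a b : ℝ) {L : ℕ+} (I : Fin L → Set ℝ)
    (X : ℕ → Ω → Fin M → ℝ) (n : ℕ) (ω : Ω) : Fin M → ℝ :=
  quantizer a b I (X n ω)

/-- The approximate filter `E_Q{ξ_t Λ_t | 𝒴_t} / E_Q{Λ_t | 𝒴_t}` built from a process `ξ` in the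
place of the state. -/
def approxFilter {Ω : Type*} [MeasurableSpace Ω] {M N : ℕ}
    (m : ℕ → (Fin M → ℝ) → EuclideanSpace ℝ (Fin N))
    (S : ℕ → (Fin M → ℝ) → Matrix (Fin N) (Fin N) ℝ) (σ : ℝ) (Q : Measure Ω)
    (y : ℕ → Ω → EuclideanSpace ℝ (Fin N)) (ξ : ℕ → Ω → Fin M → ℝ) (t : ℕ) (ω : Ω) :
    Fin M → ℝ :=
  ((Q[cumLikelihood m S σ y ξ t | obsSigma y t]) ω)⁻¹ •
    (Q[fun ω' => cumLikelihood m S σ y ξ t ω' • ξ (t + 1) ω' | obsSigma y t]) ω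

/-- The transition matrix of the marginal quantization, `P(i,j) = P(X_t ∈ cell i | X_{t-1} ∈ cell j)`;
by stationarity it does not depend on `t`, and it is written here for the first transition. (The
column of a cell that the state visits with probability zero is irrelevant; it is zero here.) -/
def transitionMatrix {Ω : Type*} [MeasurableSpace Ω] {M : ℕ} (P : Measure Ω)
    (X : ℕ → Ω → Fin M → ℝ) {L : ℕ+} (I : Fin L → Set ℝ) :
    Matrix (Fin M → Fin L) (Fin M → Fin L) ℝ :=
  Matrix.of fun i j => (P[|X 0 ⁻¹' cell I j]).real (X 1 ⁻¹' cell I i)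

/-- The vector process with values in the standard basis that belongs to the index process `Z`. -/
def basisProcess {Ω : Type*} {M : ℕ} {L : ℕ+} (Z : ℕ → Ω → Fin M → Fin L) (n : ℕ) (ω : Ω) :
    (Fin M → Fin L) → ℝ :=
  Pi.single (Z n ω) 1

/-- Under `Q` and up to the horizon `T`, the process `Z` is a Markov chain on the set of cells, with
the transition matrix of the marginal quantization, with initial mean (as a process in the standard
basis) that of the quantized initial state, and independent of the observations. -/
structure IsAuxiliaryChain {Ω : Type*} [MeasurableSpace Ω] {M N : ℕ} (T : ℕ)
    (X : ℕ → Ω → Fin M → ℝ) (y : ℕ → Ω → EuclideanSpace ℝ (Fin N)) (P Q : Measure Ω)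
    {L : ℕ+} (I : Fin L → Set ℝ) (Z : ℕ → Ω → Fin M → Fin L) : Prop where
  measurable : ∀ n, Measurable (Z n)
  indep : IndepFun (fun ω (n : Fin (T + 2)) => Z n ω) (fun ω (t : Fin (T + 1)) => y t ω) Q
  markov : ∀ n ≤ T, ∀ z : ℕ → Fin M → Fin L, P (X 0 ⁻¹' cell I (z n)) ≠ 0 →
    Q.real {ω | ∀ k ≤ n + 1, Z k ω = z k} =
      transitionMatrix P X I (z (n + 1)) (z n) * Q.real {ω | ∀ k ≤ n, Z k ω = z k}
  initial : ∫ ω, basisProcess Z 0 ω ∂Q = ∫ ω, basisQuantizer I (X 0 ω) ∂P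

/-- The approximate filter built from the chain:
`𝐗 E_Q{Z_t Λ^Z_t | 𝒴_t} / E_Q{Λ^Z_t | 𝒴_t}`, with `𝐗` the reconstruction matrix. -/
def chainFilter {Ω : Type*} [MeasurableSpace Ω] {M N : ℕ} (a b : ℝ)
    (m : ℕ → (Fin M → ℝ) → EuclideanSpace ℝ (Fin N))
    (S : ℕ → (Fin M → ℝ) → Matrix (Fin N) (Fin N) ℝ) (σ : ℝ) (Q : Measure Ω)
    (y : ℕ → Ω → EuclideanSpace ℝ (Fin N)) {L : ℕ+} (Z : ℕ → Ω → Fin M → Fin L) (t : ℕ) (ω : Ω) :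
    Fin M → ℝ :=
  let ΛZ : Ω → ℝ := cumLikelihood m S σ y (fun n ω' => recon M a b L *ᵥ basisProcess Z n ω') t
  ((Q[ΛZ | obsSigma y t]) ω)⁻¹ •
    (recon M a b L *ᵥ (Q[fun ω' => ΛZ ω' • basisProcess Z (t + 1) ω' | obsSigma y t]) ω)

/-- `sup_{t ≤ T} sup_{ω ∈ E} ‖F_t(ω) - G_t(ω)‖₁`. -/
def uniformDist {Ω : Type*} {M : ℕ} (T : ℕ) (E : Set Ω) (F G : ℕ → Ω → Fin M → ℝ) : ℝ≥0∞ :=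
  ⨆ t ≤ T, ⨆ ω ∈ E, ENNReal.ofReal (l1 (F t ω - G t ω))

end

end GridFilter

/-! ### Lebesgue densities of Gaussian laws -/

section GaussianDensity

namespace GridFilter

open scoped MatrixOrder

/-! At each time `t` the three filters are almost surely values, at the observed vector, of one
functional `pathPosterior`: a ratio of integrals of the same likelihood against a prior law on state
paths. Only the prior differs: it is the law of the state, of its quantization, or of the cell
centres visited by the chain. For the true filter this is Bayes' formula (`condExp_eq_posterior`)
applied to the joint law in `IsPartiallyObserved.map_joint`; the weight exp(‖v‖²/2) relative to
white noise does not depend on the state and cancels. For the other two it follows from independence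
under `Q` (`approxFilter_ae_eq_pathPosterior`, `chainFilter_ae_eq_pathPosterior`). Equalities
`Q`-a.s. pass to `P` because both sides are functions of the observations, whose law under `P` has a
density with respect to white noise (`ae_eq_of_ae_eq_reference`).

It remains to compare priors over compact sets. State paths lie in a product of boxes and
observations bounded by `R` in a closed ball; there the likelihood is uniformly continuous and
bounded below by a positive constant. Hence closeness of numerators and denominators, uniform in the
observation, gives closeness of the ratios (`eventually_norm_pathPosterior_sub_le`).

Quantization moves each state by at most (b-a)/L, so uniform continuity settles the first limit. For
the chain, path laws are compared in total variation. The quantized state need not be Markov, but by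
the Markov property of `X` its one-step deviation from the transition matrix is at most the `ν`-mean
of `kernelDefect`, summed over all paths. Applying the matrix does not amplify errors, so after T+1
transitions the distance is at most T+1 times this mean (`IsAuxiliaryChain.sum_abs_sub_le`).
Conditional regularity and Vitali's theorem send the mean to zero
(`ConditionallyRegular.tendsto_integral_kernelDefect`).

The exceptional probability is a fixed positive number, so it suffices to take `R` large: the events
of observations bounded by `R` increase to the whole space. -/

theorem integrable_exp_neg_half_norm_sq (N : ℕ) :
    Integrable (fun v : EuclideanSpace ℝ (Fin N) => Real.exp (-(1 / 2) * ‖v‖ ^ 2)) := by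
  have h := GaussianFourier.integrable_cexp_neg_mul_sq_norm_add (V := EuclideanSpace ℝ (Fin N))
    (b := 1 / 2) (by norm_num) 0 0
  refine h.norm.congr (Eventually.of_forall fun v => ?_)
  simp only [Complex.norm_exp]
  congr 1
  rw [show (-(1 / 2 : ℂ) * (‖v‖ : ℂ) ^ 2 + 0 * ((inner ℝ (0 : EuclideanSpace ℝ (Fin N)) v : ℝ) : ℂ))
    = ((-(1 / 2) * ‖v‖ ^ 2 : ℝ) : ℂ) by push_cast; ring]
  exact Complex.ofReal_re _

/-- Finite measures with equal characteristic functions agree; the Gaussian integral with linear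
term i⟨t, v⟩ supplies that of the right-hand side. -/
theorem stdGaussian_eq_withDensity (N : ℕ) :
    stdGaussian (EuclideanSpace ℝ (Fin N)) = volume.withDensity
      (fun v => ENNReal.ofReal ((√(2 * Real.pi) ^ N)⁻¹ * Real.exp (-(1 / 2) * ‖v‖ ^ 2))) := by
  have hint := (integrable_exp_neg_half_norm_sq N).const_mul (√(2 * Real.pi) ^ N)⁻¹
  have : IsFiniteMeasure ((volume : Measure (EuclideanSpace ℝ (Fin N))).withDensity
      (fun v => ENNReal.ofReal ((√(2 * Real.pi) ^ N)⁻¹ * Real.exp (-(1 / 2) * ‖v‖ ^ 2)))) :=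
    isFiniteMeasure_withDensity_ofReal hint.2
  apply Measure.ext_of_charFun
  ext t
  rw [charFun_stdGaussian, charFun_apply, integral_withDensity_eq_integral_toReal_smul
    (by fun_prop) (by simp)]
  have h := GaussianFourier.integral_cexp_neg_mul_sq_norm_add (V := EuclideanSpace ℝ (Fin N))
    (b := 1 / 2) (by norm_num) Complex.I t
  have hpos : (0 : ℝ) < √(2 * Real.pi) := by positivity
  calc Complex.exp (-‖t‖ ^ 2 / 2)
      = ((√(2 * Real.pi) ^ N)⁻¹ : ℝ) *
          ∫ v : EuclideanSpace ℝ (Fin N), Complex.exp (-(1 / 2) * ‖v‖ ^ 2 +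
            Complex.I * (inner ℝ t v : ℝ)) := by
        rw [h]
        -- The constant (π/β)^(N/2) of the Gaussian integral, at β = 1/2, is the normalization
        -- √(2π)^N.
        have e1 : ((Real.pi : ℂ) / (1 / 2)) ^ (Module.finrank ℝ (EuclideanSpace ℝ (Fin N)) / 2 : ℂ)
            = ((√(2 * Real.pi) ^ N : ℝ) : ℂ) := by
          rw [show ((Real.pi : ℂ) / (1 / 2)) = ((2 * Real.pi : ℝ) : ℂ) by push_cast; ring,
            show ((Module.finrank ℝ (EuclideanSpace ℝ (Fin N)) / 2 : ℂ)) = ((N / 2 : ℝ) : ℂ) by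
              simp,
            ← Complex.ofReal_cpow (by positivity)]
          congr 1
          rw [Real.sqrt_eq_rpow, ← Real.rpow_natCast, ← Real.rpow_mul (by positivity)]
          congr 1
          ring
        rw [e1, ← mul_assoc, ← Complex.ofReal_mul, inv_mul_cancel₀ (by positivity)]
        simp only [Complex.I_sq, Complex.ofReal_one, one_mul]
        congr 1
        ring
    _ = _ := by
        rw [← integral_const_mul]
        congr 1
        ext v
        rw [ENNReal.toReal_ofReal (by positivity), Complex.real_smul, Complex.ofReal_mul, mul_assoc,
          Complex.ofReal_exp, ← Complex.exp_add, real_inner_comm]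
        congr 2
        push_cast
        ring

/-- The law is the image of the standard Gaussian under x ↦ c + √C x. Positive definiteness makes √C
invertible, and the change of variables has Jacobian |det √C| = √(det C). -/
theorem multivariateGaussian_eq_withDensity {N : ℕ} (c : EuclideanSpace ℝ (Fin N))
    {C : Matrix (Fin N) (Fin N) ℝ} (hC : C.PosDef) :
    multivariateGaussian c C =
      volume.withDensity (fun v => ENNReal.ofReal (gaussianDensity c C v)) := by
  set A := CFC.sqrt C with hA
  have hAA : A * A = C := CFC.sqrt_mul_sqrt_self _ hC.posSemidef.nonneg
  have hAT : Aᵀ = A := by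
    have := (CFC.sqrt_nonneg C).isSelfAdjoint
    rw [IsSelfAdjoint, Matrix.star_eq_conjTranspose, Matrix.conjTranspose_eq_transpose_of_trivial]
      at this
    exact this
  have hdetC : C.det = A.det ^ 2 := by rw [← hAA, Matrix.det_mul, sq]
  have hdet : A.det ≠ 0 := by
    intro h
    have := hC.det_pos
    rw [hdetC, h] at this
    simp at this
  set f : EuclideanSpace ℝ (Fin N) →L[ℝ] EuclideanSpace ℝ (Fin N) :=
    Matrix.toEuclideanCLM (𝕜 := ℝ) A with hf
  have hfdet : LinearMap.det (f : EuclideanSpace ℝ (Fin N) →ₗ[ℝ] EuclideanSpace ℝ (Fin N))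
      = A.det := by
    have : (f : EuclideanSpace ℝ (Fin N) →ₗ[ℝ] EuclideanSpace ℝ (Fin N)) =
      Matrix.toLin (PiLp.basisFun 2 ℝ (Fin N)) (PiLp.basisFun 2 ℝ (Fin N)) A := rfl
    rw [this, LinearMap.det_toLin]
  -- Pulled back along x ↦ c + A x, the quadratic form C⁻¹ becomes A C⁻¹ A = 1, since A is symmetric
  -- with A² = C.
  have hdens : ∀ x, |A.det| * gaussianDensity c C (c + f x) =
      (√(2 * Real.pi) ^ N)⁻¹ * Real.exp (-(1 / 2) * ‖x‖ ^ 2) := by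
    intro x
    have hq : (c + f x - c).ofLp ⬝ᵥ (C⁻¹ *ᵥ (c + f x - c).ofLp) = ‖x‖ ^ 2 := by
      rw [add_sub_cancel_left, hf, Matrix.ofLp_toEuclideanCLM, Matrix.mulVec_mulVec, ← hAA,
        Matrix.mul_inv_rev, Matrix.nonsing_inv_mul_cancel_right _ _ (isUnit_iff_ne_zero.2 hdet),
        Matrix.dotProduct_mulVec, ← Matrix.mulVec_transpose, Matrix.transpose_nonsing_inv, hAT,
        Matrix.mulVec_mulVec, Matrix.nonsing_inv_mul _ (isUnit_iff_ne_zero.2 hdet),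
        Matrix.one_mulVec, EuclideanSpace.real_norm_sq_eq]
      simp [dotProduct, sq]
    rw [gaussianDensity, hq, ← mul_assoc]
    congr 1
    rw [hdetC, Real.sqrt_mul (by positivity), Real.sqrt_sq_eq_abs, mul_inv, mul_comm, mul_assoc,
      inv_mul_cancel₀ (abs_ne_zero.2 hdet), mul_one]
    congr 1
    rw [Real.sqrt_eq_rpow, Real.sqrt_eq_rpow, ← Real.rpow_natCast, ← Real.rpow_natCast,
      ← Real.rpow_mul (by positivity), ← Real.rpow_mul (by positivity)]
    congr 1
    ring
  have hgm : Measurable (gaussianDensity c C) := by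
    unfold gaussianDensity
    simp only [dotProduct, Matrix.mulVec]
    fun_prop
  have hvol : (volume : Measure (EuclideanSpace ℝ (Fin N))) =
      ENNReal.ofReal |A.det| • (volume : Measure (EuclideanSpace ℝ (Fin N))).map
        (fun x => c + f x) := by
    have h1 : (fun x => c + f x) = (fun x => c + x) ∘ f := rfl
    have h2 := Measure.map_linearMap_addHaar_eq_smul_addHaar
      (volume : Measure (EuclideanSpace ℝ (Fin N)))
      (f := (f : EuclideanSpace ℝ (Fin N) →ₗ[ℝ] EuclideanSpace ℝ (Fin N))) (by rwa [hfdet])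
    rw [hfdet, ContinuousLinearMap.coe_coe] at h2
    rw [h1, ← Measure.map_map (by fun_prop) (by fun_prop), h2, Measure.map_smul,
      map_add_left_eq_self, smul_smul, ← ENNReal.ofReal_mul (by positivity), ← abs_mul,
      mul_inv_cancel₀ hdet]
    simp
  have hfm : Measurable (fun x => c + f x) := by fun_prop
  ext s hs
  rw [multivariateGaussian, Measure.map_apply hfm hs, stdGaussian_eq_withDensity,
    withDensity_apply _ (hfm hs), withDensity_apply _ hs]
  conv_rhs => rw [hvol]
  rw [Measure.restrict_smul, lintegral_smul_measure, setLIntegral_map hs (by fun_prop) hfm,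
    smul_eq_mul, ← lintegral_const_mul _ (by fun_prop)]
  refine lintegral_congr fun x => ?_
  rw [← ENNReal.ofReal_mul (by positivity), hdens]

/-- The factor exp(‖v‖²/2) is kept apart because it depends on neither mean nor covariance, hence
not on the state; what remains is the likelihood. -/
theorem multivariateGaussian_eq_stdGaussian_withDensity {N : ℕ} (c : EuclideanSpace ℝ (Fin N))
    {C : Matrix (Fin N) (Fin N) ℝ} (hC : C.PosDef) :
    multivariateGaussian c C = (stdGaussian (EuclideanSpace ℝ (Fin N))).withDensity
      (fun v => ENNReal.ofReal
        (Real.exp (1 / 2 * ‖v‖ ^ 2) * (√(2 * Real.pi) ^ N * gaussianDensity c C v))) := by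
  have hgm : Measurable (gaussianDensity c C) := by
    unfold gaussianDensity
    simp only [dotProduct, Matrix.mulVec]
    fun_prop
  rw [multivariateGaussian_eq_withDensity c hC, stdGaussian_eq_withDensity,
    ← withDensity_mul _ (by fun_prop) (by fun_prop)]
  congr 1
  ext v
  rw [Pi.mul_apply, ← ENNReal.ofReal_mul (by positivity)]
  congr 1
  have : (√(2 * Real.pi) ^ N) ≠ 0 := by positivity
  rw [show -(1 / 2) * ‖v‖ ^ 2 = -(1 / 2 * ‖v‖ ^ 2) by ring, Real.exp_neg]
  field_simp

end GridFilter

end GaussianDensity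

/-! ### The likelihood on the state box -/

section BoxLikelihood

namespace GridFilter

variable {M N : ℕ} {a b : ℝ}

theorem l1_le_card_mul_norm {ι : Type*} [Fintype ι] (v : ι → ℝ) :
    l1 v ≤ Fintype.card ι * ‖v‖ := by
  unfold l1
  calc ∑ i, |v i| ≤ ∑ _i : ι, ‖v‖ := Finset.sum_le_sum fun i _ => norm_le_pi_norm v i
    _ = _ := by simp

theorem abs_le_l1 {ι : Type*} [Fintype ι] (v : ι → ℝ) (i : ι) : |v i| ≤ l1 v :=
  Finset.single_le_sum (f := fun i => |v i|) (fun _ _ => abs_nonneg _) (Finset.mem_univ i)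

theorem continuousOn_of_abs_sub_le_l1 {f : (Fin M → ℝ) → ℝ} {K : ℝ} {s : Set (Fin M → ℝ)}
    (h : ∀ x ∈ s, ∀ x' ∈ s, |f x - f x'| ≤ K * l1 (x - x')) : ContinuousOn f s := by
  intro x₀ hx₀
  rw [ContinuousWithinAt, tendsto_iff_norm_sub_tendsto_zero]
  have hc : Continuous fun x : Fin M → ℝ => K * l1 (x - x₀) := by
    unfold l1
    fun_prop
  have h0 : Tendsto (fun x : Fin M → ℝ => K * l1 (x - x₀)) (𝓝[s] x₀) (𝓝 0) := by
    have := hc.tendsto x₀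
    simp only [sub_self] at this
    rw [show K * l1 (0 : Fin M → ℝ) = 0 by simp [l1]] at this
    exact this.mono_left nhdsWithin_le_nhds
  refine squeeze_zero' (Eventually.of_forall fun _ => norm_nonneg _) ?_ h0
  filter_upwards [self_mem_nhdsWithin] with x hx
  exact h x hx x₀ hx₀

/-- The nearest point of `[a,b]^M`. -/
def clamp (a b : ℝ) (x : Fin M → ℝ) : Fin M → ℝ := fun i => max a (min b (x i))

theorem clamp_mem_box (hab : a ≤ b) (x : Fin M → ℝ) : clamp a b x ∈ box M a b :=
  ⟨fun _ => le_max_left _ _, fun _ => max_le hab (min_le_left _ _)⟩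

theorem clamp_of_mem {x : Fin M → ℝ} (hx : x ∈ box M a b) : clamp a b x = x := by
  ext i
  rw [clamp, min_eq_right (hx.2 i), max_eq_right (hx.1 i)]

theorem continuous_clamp : Continuous (clamp a b : (Fin M → ℝ) → Fin M → ℝ) := by
  unfold clamp
  fun_prop

variable {m : ℕ → (Fin M → ℝ) → EuclideanSpace ℝ (Fin N)}
  {S : ℕ → (Fin M → ℝ) → Matrix (Fin N) (Fin N) ℝ} {σ : ℝ}

theorem ObsAssumptions.posDef_obsCov (h : ObsAssumptions a b m S σ) (t : ℕ) {x : Fin M → ℝ}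
    (hx : x ∈ box M a b) : (obsCov S σ t x).PosDef :=
  (h.posDef t x hx).add_posSemidef (Matrix.PosSemidef.one.smul (sq_nonneg σ))

/-- The likelihood, with the state projected to `[a,b]^M`. -/
noncomputable def boxLikelihood (a b : ℝ) (m : ℕ → (Fin M → ℝ) → EuclideanSpace ℝ (Fin N))
    (S : ℕ → (Fin M → ℝ) → Matrix (Fin N) (Fin N) ℝ) (σ : ℝ) (t : ℕ)
    (p : (Fin M → ℝ) × EuclideanSpace ℝ (Fin N)) : ℝ :=
  likelihood m S σ t (clamp a b p.1) p.2

theorem boxLikelihood_of_mem {t : ℕ} {x : Fin M → ℝ} (hx : x ∈ box M a b)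
    (v : EuclideanSpace ℝ (Fin N)) :
    boxLikelihood a b m S σ t (x, v) = likelihood m S σ t x v := by
  rw [boxLikelihood, clamp_of_mem hx]

theorem ObsAssumptions.continuous_mean (h : ObsAssumptions a b m S σ) (hab : a ≤ b) (t : ℕ) :
    Continuous fun x => m t (clamp a b x) := by
  obtain ⟨K, hK⟩ := h.mean_lipschitz
  have h1 : ContinuousOn (m t) (box M a b) := by
    have : ContinuousOn (fun x => (m t x).ofLp) (box M a b) :=
      continuousOn_pi.2 fun i => continuousOn_of_abs_sub_le_l1 fun x hx x' hx' =>
        (abs_le_l1 (fun i => m t x i - m t x' i) i).trans (hK t x hx x' hx')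
    exact (PiLp.continuous_toLp 2 _).comp_continuousOn this
  exact h1.comp_continuous continuous_clamp (clamp_mem_box hab)

theorem ObsAssumptions.continuous_obsCov (h : ObsAssumptions a b m S σ) (hab : a ≤ b) (t : ℕ) :
    Continuous fun x => obsCov S σ t (clamp a b x) := by
  obtain ⟨K, hK⟩ := h.cov_lipschitz
  have h1 : ContinuousOn (S t) (box M a b) :=
    continuousOn_pi.2 fun i => continuousOn_pi.2 fun j =>
      continuousOn_of_abs_sub_le_l1 fun x hx x' hx' => hK t x hx x' hx' i j
  exact (h1.comp_continuous continuous_clamp (clamp_mem_box hab)).add continuous_const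

/-- The model is controlled only on the box, so states are clamped to it first. The clamped
covariance is positive definite everywhere, hence its inverse, adjugate over determinant, is
continuous. -/
theorem ObsAssumptions.continuous_boxLikelihood (h : ObsAssumptions a b m S σ) (hab : a ≤ b)
    (t : ℕ) : Continuous (boxLikelihood a b m S σ t) := by
  have hm := (h.continuous_mean hab t).comp
    (continuous_fst (X := Fin M → ℝ) (Y := EuclideanSpace ℝ (Fin N)))
  have hC := (h.continuous_obsCov hab t).comp
    (continuous_fst (X := Fin M → ℝ) (Y := EuclideanSpace ℝ (Fin N)))
  have hdet : ∀ x : Fin M → ℝ, 0 < (obsCov S σ t (clamp a b x)).det := fun x =>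
    (h.posDef_obsCov t (clamp_mem_box hab x)).det_pos
  have hinv : Continuous fun p : (Fin M → ℝ) × EuclideanSpace ℝ (Fin N) =>
      (obsCov S σ t (clamp a b p.1))⁻¹ := by
    simp only [Matrix.inv_def, Ring.inverse_eq_inv']
    exact (hC.matrix_det.inv₀ fun p => (hdet p.1).ne').smul hC.matrix_adjugate
  have hd : Continuous fun p : (Fin M → ℝ) × EuclideanSpace ℝ (Fin N) =>
      (p.2 - m t (clamp a b p.1)).ofLp :=
    (PiLp.continuous_ofLp 2 _).comp (continuous_snd.sub hm)
  unfold boxLikelihood likelihood gaussianDensity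
  refine continuous_const.mul (Continuous.mul ?_ ?_)
  · refine (Real.continuous_sqrt.comp (continuous_const.mul hC.matrix_det)).inv₀ fun p => ?_
    have := hdet p.1
    exact (Real.sqrt_pos.2 (mul_pos (by positivity) this)).ne'
  · exact Real.continuous_exp.comp
      (continuous_const.mul (hd.dotProduct (hinv.matrix_mulVec hd)))

theorem ObsAssumptions.boxLikelihood_pos (h : ObsAssumptions a b m S σ) (hab : a ≤ b)
    (t : ℕ) (p : (Fin M → ℝ) × EuclideanSpace ℝ (Fin N)) : 0 < boxLikelihood a b m S σ t p := by
  have hdet := (h.posDef_obsCov t (clamp_mem_box hab p.1)).det_pos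
  unfold boxLikelihood likelihood gaussianDensity
  positivity

/-- The exponential is at most 1 for every observation, and the normalizing factor is a continuous
function of the state on a compact box. -/
theorem ObsAssumptions.exists_boxLikelihood_le (h : ObsAssumptions a b m S σ) (hab : a ≤ b)
    (t : ℕ) : ∃ B : ℝ, ∀ p, boxLikelihood a b m S σ t p ≤ B := by
  have hdet : ∀ x : Fin M → ℝ, 0 < (obsCov S σ t (clamp a b x)).det := fun x =>
    (h.posDef_obsCov t (clamp_mem_box hab x)).det_pos
  have hcont : Continuous fun x : Fin M → ℝ =>
      √(2 * Real.pi) ^ N * (√((2 * Real.pi) ^ N * (obsCov S σ t (clamp a b x)).det))⁻¹ := by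
    refine continuous_const.mul ((Real.continuous_sqrt.comp
      (continuous_const.mul (h.continuous_obsCov hab t).matrix_det)).inv₀ fun x => ?_)
    exact (Real.sqrt_pos.2 (mul_pos (by positivity) (hdet x))).ne'
  obtain ⟨B, hB⟩ := (isCompact_Icc (a := fun _ : Fin M => a) (b := fun _ => b)).bddAbove_image
    hcont.continuousOn
  refine ⟨B, fun p => le_trans ?_ (hB ⟨clamp a b p.1, clamp_mem_box hab p.1, rfl⟩)⟩
  beta_reduce
  -- The bound was taken at a point already clamped, so the clamp occurs twice and collapses.
  rw [clamp_of_mem (clamp_mem_box hab p.1)]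
  unfold boxLikelihood likelihood gaussianDensity
  refine mul_le_mul_of_nonneg_left (mul_le_of_le_one_right (by positivity) ?_) (by positivity)
  rw [Real.exp_le_one_iff]
  have hq := (h.posDef_obsCov t (clamp_mem_box hab p.1)).inv.posSemidef.dotProduct_mulVec_nonneg
    (p.2 - m t (clamp a b p.1)).ofLp
  rw [star_trivial] at hq
  linarith

theorem ObsAssumptions.multivariateGaussian_eq (h : ObsAssumptions a b m S σ) (t : ℕ)
    {x : Fin M → ℝ} (hx : x ∈ box M a b) :
    multivariateGaussian (m t x) (obsCov S σ t x) =
      (stdGaussian (EuclideanSpace ℝ (Fin N))).withDensity fun v => ENNReal.ofReal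
        (Real.exp (1 / 2 * ‖v‖ ^ 2) * boxLikelihood a b m S σ t (x, v)) := by
  rw [multivariateGaussian_eq_stdGaussian_withDensity _ (h.posDef_obsCov t hx)]
  simp only [boxLikelihood_of_mem hx]
  rfl

end GridFilter

end BoxLikelihood

/-! ### Conditional expectations from product and dominated joint laws -/

section Bayes

namespace GridFilter

variable {Ω α β F : Type*} [MeasurableSpace Ω] [MeasurableSpace α] [MeasurableSpace β]
  [NormedAddCommGroup F] [NormedSpace ℝ F]

/-- Events of σ(V) are preimages of the strips `univ ×ˢ B`, so the defining integrals of the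
conditional expectation can be checked on the joint law alone. -/
theorem condExp_eq_comp_of_setIntegral_map_eq [CompleteSpace F] {P : Measure Ω} [IsFiniteMeasure P] {U : Ω → α}
    {V : Ω → β} (hU : Measurable U) (hV : Measurable V) {ρ : Measure (α × β)}
    (hmap : P.map (fun ω => (U ω, V ω)) = ρ) {G : α × β → F} {φ : β → F}
    (hGi : Integrable G ρ) (hφ : StronglyMeasurable φ) (hφi : Integrable (fun p => φ p.2) ρ)
    (h : ∀ B, MeasurableSet B →
      ∫ p in Set.univ ×ˢ B, φ p.2 ∂ρ = ∫ p in Set.univ ×ˢ B, G p ∂ρ) :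
    P[fun ω => G (U ω, V ω) | MeasurableSpace.comap V inferInstance] =ᵐ[P] fun ω => φ (V ω) := by
  subst hmap
  have hUV : Measurable fun ω => (U ω, V ω) := hU.prodMk hV
  refine (ae_eq_condExp_of_forall_setIntegral_eq hV.comap_le (hGi.comp_measurable hUV)
    (fun s _ _ => (hφi.comp_measurable hUV).integrableOn) ?_
    (hφ.comp_measurable (comap_measurable V)).aestronglyMeasurable).symm
  rintro _ ⟨B, hB, rfl⟩ -
  have h1 : V ⁻¹' B = (fun ω => (U ω, V ω)) ⁻¹' (Set.univ ×ˢ B) := by ext; simp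
  have h2 := h B hB
  rw [setIntegral_map (MeasurableSet.univ.prod hB) hφi.1 hUV.aemeasurable,
    setIntegral_map (MeasurableSet.univ.prod hB) hGi.1 hUV.aemeasurable] at h2
  rw [h1]
  exact h2

theorem setIntegral_univ_prod {π : Measure α} {μ : Measure β} [SFinite π] [SFinite μ]
    {G : α × β → F} (hG : Integrable G (π.prod μ)) (B : Set β) :
    ∫ p in Set.univ ×ˢ B, G p ∂π.prod μ = ∫ v in B, ∫ x, G (x, v) ∂π ∂μ := by
  have hG' := hG.integrableOn (s := Set.univ ×ˢ B)
  rw [IntegrableOn] at hG'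
  rw [← Measure.prod_restrict, Measure.restrict_univ] at hG' ⊢
  exact integral_prod_symm _ hG'

/-- Under independence, conditioning on `V` freezes `V` and averages over `U`; this is Fubini on the
strips. -/
theorem condExp_of_map_eq_prod [CompleteSpace F] {Q : Measure Ω} [IsFiniteMeasure Q] {U : Ω → α} {V : Ω → β}
    (hU : Measurable U) (hV : Measurable V) {π : Measure α} {μ : Measure β}
    [IsProbabilityMeasure π] [SFinite μ]
    (hmap : Q.map (fun ω => (U ω, V ω)) = π.prod μ) {G : α × β → F} (hG : StronglyMeasurable G)
    (hGi : Integrable G (π.prod μ)) :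
    Q[fun ω => G (U ω, V ω) | MeasurableSpace.comap V inferInstance] =ᵐ[Q] fun ω => ∫ x, G (x, V ω) ∂π := by
  have hi : Integrable (fun p : α × β => ∫ x, G (x, p.2) ∂π) (π.prod μ) :=
    hGi.integral_prod_right.comp_snd π
  refine condExp_eq_comp_of_setIntegral_map_eq hU hV hmap hGi hG.integral_prod_left' hi ?_
  intro B _
  rw [setIntegral_univ_prod hi, setIntegral_univ_prod hGi]
  simp

/-- The posterior mean of `f` under the prior `π`, for the likelihood `Λ` and the observation `v`. -/
noncomputable def posterior (π : Measure α) (Λ : α × β → ℝ) (f : α → F) (v : β) : F :=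
  (∫ x, Λ (x, v) ∂π)⁻¹ • ∫ x, Λ (x, v) • f x ∂π

theorem stronglyMeasurable_posterior {π : Measure α} [SFinite π] {Λ : α × β → ℝ} {f : α → F}
    (hΛ : StronglyMeasurable Λ) (hf : StronglyMeasurable f) :
    StronglyMeasurable (posterior π Λ f) := by
  have h1 : StronglyMeasurable fun v => ∫ x, Λ (x, v) ∂π := hΛ.integral_prod_left'
  have h2 : StronglyMeasurable fun v => ∫ x, Λ (x, v) • f x ∂π :=
    (hΛ.smul (hf.comp_measurable measurable_fst)).integral_prod_left'
  exact h1.inv₀.smul h2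

theorem norm_posterior_le {β : Type*} {π : Measure α} [IsProbabilityMeasure π] {Λ : α × β → ℝ} {f : α → F}
    (hpos : ∀ p, 0 ≤ Λ p) {v : β} (hΛ : Integrable (fun x => Λ (x, v)) π) {R : ℝ} (hR : 0 ≤ R)
    (hf : ∀ᵐ x ∂π, ‖f x‖ ≤ R) : ‖posterior π Λ f v‖ ≤ R := by
  have h0 : 0 ≤ ∫ x, Λ (x, v) ∂π := integral_nonneg fun _ => hpos _
  have h1 : ‖∫ x, Λ (x, v) • f x ∂π‖ ≤ (∫ x, Λ (x, v) ∂π) * R := by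
    rw [← integral_mul_const]
    refine norm_integral_le_of_norm_le (hΛ.mul_const R) ?_
    filter_upwards [hf] with x hx
    rw [norm_smul, Real.norm_of_nonneg (hpos _)]
    exact mul_le_mul_of_nonneg_left hx (hpos _)
  rw [posterior, norm_smul, norm_inv, Real.norm_of_nonneg h0]
  -- If the denominator vanishes, the convention `0⁻¹ = 0` makes the posterior zero, whence the
  -- assumption `0 ≤ R`.
  rcases h0.eq_or_lt with h | h
  · rw [← h]
    simpa using hR
  · rw [inv_mul_le_iff₀ h]
    exact h1

/-- Bayes' formula. -/
theorem condExp_eq_posterior [CompleteSpace F] {P : Measure Ω} [IsFiniteMeasure P] {U : Ω → α} {V : Ω → β}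
    (hU : Measurable U) (hV : Measurable V) {π : Measure α} {μ : Measure β}
    [IsProbabilityMeasure π] [SFinite μ] {Λ : α × β → ℝ} {w : β → ℝ}
    (hmap : P.map (fun ω => (U ω, V ω)) =
      (π.prod μ).withDensity fun p => ENNReal.ofReal (w p.2 * Λ p))
    (hΛ : StronglyMeasurable Λ) (hpos : ∀ p, 0 < Λ p) (hw : Measurable w) (hw0 : ∀ v, 0 ≤ w v)
    (hΛi : ∀ v, Integrable (fun x => Λ (x, v)) π)
    {f : α → F} (hf : StronglyMeasurable f) {R : ℝ} (hR : 0 ≤ R) (hfR : ∀ᵐ x ∂π, ‖f x‖ ≤ R) :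
    P[fun ω => f (U ω) | MeasurableSpace.comap V inferInstance] =ᵐ[P] fun ω => posterior π Λ f (V ω) := by
  have hUV : Measurable fun ω => (U ω, V ω) := hU.prodMk hV
  have hwΛ : Measurable fun p : α × β => w p.2 * Λ p :=
    (hw.comp measurable_snd).mul hΛ.measurable
  have hd : Measurable fun p : α × β => ENNReal.ofReal (w p.2 * Λ p) := hwΛ.ennreal_ofReal
  have hd0 : ∀ p : α × β, 0 ≤ w p.2 * Λ p := fun p => mul_nonneg (hw0 _) (hpos p).le
  have hfin : IsFiniteMeasure ((π.prod μ).withDensity fun p => ENNReal.ofReal (w p.2 * Λ p)) := by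
    rw [← hmap]; infer_instance
  have hfi : Integrable (fun p : α × β => f p.1)
      ((π.prod μ).withDensity fun p => ENNReal.ofReal (w p.2 * Λ p)) := by
    refine Integrable.of_bound (hf.comp_measurable measurable_fst).aestronglyMeasurable R ?_
    refine (withDensity_absolutelyContinuous _ _).ae_le ?_
    exact Measure.quasiMeasurePreserving_fst.ae hfR
  have hφi : Integrable (fun p : α × β => posterior π Λ f p.2)
      ((π.prod μ).withDensity fun p => ENNReal.ofReal (w p.2 * Λ p)) :=
    Integrable.of_bound ((stronglyMeasurable_posterior hΛ hf).comp_measurable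
      measurable_snd).aestronglyMeasurable R (Eventually.of_forall fun p =>
        norm_posterior_le (fun p => (hpos p).le) (hΛi _) hR hfR)
  refine condExp_eq_comp_of_setIntegral_map_eq hU hV hmap hfi
    (stronglyMeasurable_posterior hΛ hf) hφi ?_
  intro B hB
  have hwd : ∀ g : α × β → F, ∫ p in Set.univ ×ˢ B, g p
      ∂((π.prod μ).withDensity fun p => ENNReal.ofReal (w p.2 * Λ p)) =
      ∫ p in Set.univ ×ˢ B, (ENNReal.ofReal (w p.2 * Λ p)).toReal • g p ∂(π.prod μ) := fun g =>
    setIntegral_withDensity_eq_setIntegral_toReal_smul hd (by simp) g (MeasurableSet.univ.prod hB)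
  rw [hwd, hwd]
  -- The density is moved into the integrands so that Fubini applies to the product measure; for
  -- fixed `v` the two inner integrals are then compared.
  rw [integrable_withDensity_iff_integrable_smul' hd (by simp)] at hfi hφi
  rw [setIntegral_univ_prod hfi, setIntegral_univ_prod hφi]
  congr 1
  ext v
  have hd1 : ∀ x, (ENNReal.ofReal (w v * Λ (x, v))).toReal = w v * Λ (x, v) := fun x =>
    ENNReal.toReal_ofReal (hd0 (x, v))
  simp only [hd1, mul_smul]
  rw [integral_smul, integral_smul, integral_smul_const, posterior, smul_smul, smul_smul]
  -- A strictly positive likelihood has positive integral, so the posterior's normalization cancels;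
  -- the weight `w v` is common to both sides.
  have hΛv : 0 < ∫ x, Λ (x, v) ∂π := by
    rw [integral_pos_iff_support_of_nonneg (fun _ => (hpos _).le) (hΛi v),
      Function.support_eq_univ fun x => (hpos _).ne']
    simp
  rw [mul_inv_cancel_right₀ hΛv.ne']

end GridFilter

end Bayes

/-! ### Joint laws of state and observations -/

section JointLaws

namespace GridFilter

variable {Ω : Type*} {M N : ℕ} {a b : ℝ}
  {m : ℕ → (Fin M → ℝ) → EuclideanSpace ℝ (Fin N)}
  {S : ℕ → (Fin M → ℝ) → Matrix (Fin N) (Fin N) ℝ} {σ : ℝ}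
  {X : ℕ → Ω → Fin M → ℝ} {y : ℕ → Ω → EuclideanSpace ℝ (Fin N)} {T : ℕ}

/-- The first `n` values of a process, as one random vector. -/
def initialPath {E : Type*} (n : ℕ) (ξ : ℕ → Ω → E) (ω : Ω) (k : Fin n) : E := ξ k ω

theorem measurable_initialPath [MeasurableSpace Ω] {E : Type*} [MeasurableSpace E] {ξ : ℕ → Ω → E}
    (hξ : ∀ n, Measurable (ξ n)) (n : ℕ) : Measurable (initialPath n ξ) :=
  measurable_pi_lambda _ fun k => hξ k

/-- Conditioning on the observations up to `t` thereby becomes conditioning on a single random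
vector. -/
theorem obsSigma_eq_comap (y : ℕ → Ω → EuclideanSpace ℝ (Fin N)) (t : ℕ) :
    obsSigma y t = MeasurableSpace.comap (initialPath (t + 1) y) inferInstance := by
  apply le_antisymm
  · refine iSup₂_le fun s hs => ?_
    have : y s = (fun v : Fin (t + 1) → EuclideanSpace ℝ (Fin N) => v ⟨s, by omega⟩) ∘
      initialPath (t + 1) y := rfl
    rw [this, ← MeasurableSpace.comap_comp]
    exact MeasurableSpace.comap_mono (measurable_pi_apply _).comap_le
  · rw [MeasurableSpace.pi, MeasurableSpace.comap_iSup]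
    refine iSup_le fun s => ?_
    rw [MeasurableSpace.comap_comp]
    exact le_iSup₂ (f := fun s (_ : s ≤ t) => MeasurableSpace.comap (y s) inferInstance) (s : ℕ)
      (by omega)

/-- The likelihood of a sequence of observations along a path of states. -/
noncomputable def pathLikelihood (a b : ℝ) (m : ℕ → (Fin M → ℝ) → EuclideanSpace ℝ (Fin N))
    (S : ℕ → (Fin M → ℝ) → Matrix (Fin N) (Fin N) ℝ) (σ : ℝ) (t : ℕ)
    (p : (Fin (t + 2) → Fin M → ℝ) × (Fin (t + 1) → EuclideanSpace ℝ (Fin N))) : ℝ :=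
  ∏ s : Fin (t + 1), boxLikelihood a b m S σ s (p.1 s.succ, p.2 s)

theorem ObsAssumptions.continuous_pathLikelihood (h : ObsAssumptions a b m S σ) (hab : a ≤ b)
    (t : ℕ) : Continuous (pathLikelihood a b m S σ t) := by
  refine continuous_finsetProd _ fun s _ => (h.continuous_boxLikelihood hab s).comp ?_
  fun_prop

theorem ObsAssumptions.pathLikelihood_pos (h : ObsAssumptions a b m S σ) (hab : a ≤ b)
    (t : ℕ) (p) : 0 < pathLikelihood a b m S σ t p :=
  Finset.prod_pos fun s _ => h.boxLikelihood_pos hab s _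

theorem ObsAssumptions.exists_pathLikelihood_le (h : ObsAssumptions a b m S σ) (hab : a ≤ b)
    (t : ℕ) : ∃ B : ℝ, 0 ≤ B ∧ ∀ p, pathLikelihood a b m S σ t p ≤ B := by
  choose B hB using fun s => h.exists_boxLikelihood_le hab s
  have hB0 : ∀ s, 0 ≤ B s := fun s => (h.boxLikelihood_pos hab s (0, 0)).le.trans (hB s _)
  exact ⟨∏ s : Fin (t + 1), B s, Finset.prod_nonneg fun s _ => hB0 s, fun p =>
    Finset.prod_le_prod (fun s _ => (h.boxLikelihood_pos hab s _).le) fun s _ => hB s _⟩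

/-- Observation `s` is paired with state index `s + 1`; index 0, the initial state, carries no
likelihood factor. -/
theorem cumLikelihood_eq_pathLikelihood {ξ : ℕ → Ω → Fin M → ℝ} {t : ℕ} {ω : Ω}
    (h : ∀ n ≤ t + 1, ξ n ω ∈ box M a b) :
    cumLikelihood m S σ y ξ t ω =
      pathLikelihood a b m S σ t (initialPath (t + 2) ξ ω, initialPath (t + 1) y ω) := by
  rw [cumLikelihood, pathLikelihood, Finset.prod_range]
  refine Finset.prod_congr rfl fun s _ => ?_
  rw [boxLikelihood_of_mem]
  · rfl
  · exact h _ (by simp only [Fin.val_succ]; omega)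

/-- The density of the Gaussian observations with respect to white noise, up to the likelihood. -/
noncomputable def noiseWeight (t : ℕ) (v : Fin (t + 1) → EuclideanSpace ℝ (Fin N)) : ℝ :=
  ∏ s, Real.exp (1 / 2 * ‖v s‖ ^ 2)

theorem noiseWeight_pos (t : ℕ) (v : Fin (t + 1) → EuclideanSpace ℝ (Fin N)) :
    0 < noiseWeight t v := Finset.prod_pos fun _ _ => Real.exp_pos _

theorem measurable_noiseWeight (t : ℕ) : Measurable (noiseWeight (N := N) t) := by
  unfold noiseWeight
  fun_prop

variable [MeasurableSpace Ω] {P Q : Measure Ω}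

/-- The filter at time `t` sees only the path up to `t`, so each `t ≤ T` is treated with its own
horizon. -/
theorem IsReferenceMeasure.mono (h : IsReferenceMeasure T X y P Q)
    (hX : ∀ n, Measurable (X n)) {t : ℕ} (ht : t ≤ T) : IsReferenceMeasure t X y P Q := by
  have hr : Measurable fun (x : Fin (T + 2) → Fin M → ℝ) (n : Fin (t + 2)) =>
      x (Fin.castLE (by omega) n) := by fun_prop
  have hr' : Measurable fun (v : Fin (T + 1) → EuclideanSpace ℝ (Fin N)) (n : Fin (t + 1)) =>
      v (Fin.castLE (by omega) n) := by fun_prop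
  refine ⟨?_, fun s hs => h.map_obs s (hs.trans ht), ?_, h.indep.comp hr hr'⟩
  · have h1 := congrArg (Measure.map fun (x : Fin (T + 2) → Fin M → ℝ) (n : Fin (t + 2)) =>
      x (Fin.castLE (by omega) n)) h.map_state
    have hX' : Measurable fun ω (n : Fin (T + 2)) => X n ω := measurable_pi_lambda _ fun k => hX k
    rwa [Measure.map_map hr hX', Measure.map_map hr hX'] at h1
  · exact h.iIndep_obs.precomp (g := Fin.castLE (by omega : t + 1 ≤ T + 1))
      (Fin.castLE_injective _)

theorem IsReferenceMeasure.map_initialPath_obs [IsProbabilityMeasure Q]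
    (h : IsReferenceMeasure T X y P Q) (hy : ∀ t, Measurable (y t)) :
    Q.map (initialPath (T + 1) y) =
      Measure.pi fun _ => stdGaussian (EuclideanSpace ℝ (Fin N)) := by
  have h1 := (iIndepFun_iff_map_fun_eq_pi_map (fun t : Fin (T + 1) =>
    (hy t).aemeasurable)).1 h.iIndep_obs
  refine h1.trans ?_
  congr 1
  ext1 t
  exact h.map_obs t (by omega)

/-- The indicator of a rectangle also factorizes over coordinates, and coordinates are independent
under a product measure. -/
theorem lintegral_pi_prod_withDensity {n : ℕ} {E : Type*} [MeasurableSpace E] (γ : Measure E)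
    [IsProbabilityMeasure γ] {f : Fin n → E → ℝ≥0∞} (hf : ∀ s, Measurable (f s)) {B : Fin n → Set E}
    (hB : ∀ s, MeasurableSet (B s)) :
    ∫⁻ v in Set.univ.pi B, ∏ s, f s (v s) ∂(Measure.pi fun _ => γ) =
      ∏ s, γ.withDensity (f s) (B s) := by
  have hB' : MeasurableSet (Set.univ.pi B) := MeasurableSet.univ_pi hB
  have hg : ∀ s, Measurable ((B s).indicator (f s)) := fun s => (hf s).indicator (hB s)
  rw [← lintegral_indicator hB']
  have h1 : ∀ v, (Set.univ.pi B).indicator (fun v => ∏ s, f s (v s)) v =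
      ∏ s, (B s).indicator (f s) (v s) := by
    intro v
    by_cases hv : v ∈ Set.univ.pi B
    · rw [Set.indicator_of_mem hv]
      exact Finset.prod_congr rfl fun s _ => (Set.indicator_of_mem (hv s trivial) _).symm
    · rw [Set.indicator_of_notMem hv]
      simp only [Set.mem_pi, Set.mem_univ, true_imp_iff, not_forall] at hv
      obtain ⟨s, hs⟩ := hv
      exact (Finset.prod_eq_zero (Finset.mem_univ s) (Set.indicator_of_notMem hs _)).symm
  simp only [h1]
  have hind : iIndepFun (fun (s : Fin n) (v : Fin n → E) => (B s).indicator (f s) (v s))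
      (Measure.pi fun _ => γ) := iIndepFun_pi fun s => (hg s).aemeasurable
  rw [lintegral_prod_eq_prod_lintegral_of_indepFun Finset.univ _ hind
    fun s => (hg s).comp (measurable_pi_apply s)]
  refine Finset.prod_congr rfl fun s _ => ?_
  rw [withDensity_apply _ (hB s), ← lintegral_indicator (hB s)]
  exact (measurePreserving_eval (fun _ : Fin n => γ) s).lintegral_comp (hg s)

theorem measurable_withDensity_apply {α E : Type*} [MeasurableSpace α] [MeasurableSpace E]
    {γ : Measure E} [SFinite γ] {f : α → E → ℝ≥0∞} (hf : Measurable (Function.uncurry f))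
    {B : Set E} (hB : MeasurableSet B) : Measurable fun x => γ.withDensity (f x) B := by
  simp only [withDensity_apply _ hB]
  exact hf.lintegral_prod_right'

theorem measurable_prod_eval {α E : Type*} [MeasurableSpace α] [MeasurableSpace E] {n : ℕ}
    {f : Fin n → α → E → ℝ≥0∞} (hf : ∀ s, Measurable (Function.uncurry (f s))) :
    Measurable fun p : α × (Fin n → E) => ∏ s, f s p.1 (p.2 s) := by
  refine Finset.measurable_prod _ fun s _ => ?_
  have hg : Measurable fun p : α × (Fin n → E) => (p.1, p.2 s) := by fun_prop
  exact (hf s).comp hg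

/-- Tonelli in the first variable brings rectangle masses into the form in which the conditional law
of the observations is prescribed. -/
theorem withDensity_prod_pi_apply {α E : Type*} [MeasurableSpace α] [MeasurableSpace E] {n : ℕ}
    (π : Measure α) [SFinite π] (γ : Measure E) [IsProbabilityMeasure γ]
    {f : Fin n → α → E → ℝ≥0∞} (hf : ∀ s, Measurable (Function.uncurry (f s)))
    {A : Set α} (hA : MeasurableSet A) {B : Fin n → Set E} (hB : ∀ s, MeasurableSet (B s)) :
    ((π.prod (Measure.pi fun _ => γ)).withDensity fun p => ∏ s, f s p.1 (p.2 s))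
      (A ×ˢ Set.univ.pi B) = ∫⁻ x in A, ∏ s, γ.withDensity (f s x) (B s) ∂π := by
  rw [withDensity_apply _ (hA.prod (MeasurableSet.univ_pi hB)),
    setLIntegral_prod _ (measurable_prod_eval hf).aemeasurable]
  refine lintegral_congr fun x => ?_
  exact lintegral_pi_prod_withDensity γ (fun s => (hf s).comp measurable_prodMk_left) hB

/-- Such rectangles form a π-system generating the σ-algebra, and the full rectangle compares the
total masses. -/
theorem ext_of_prod_pi {α ι : Type*} [Finite ι] {E : ι → Type*} [MeasurableSpace α]
    [∀ i, MeasurableSpace (E i)] {ρ ρ' : Measure (α × (∀ i, E i))} [IsFiniteMeasure ρ]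
    (h : ∀ (A : Set α) (B : ∀ i, Set (E i)), MeasurableSet A → (∀ i, MeasurableSet (B i)) →
      ρ (A ×ˢ Set.univ.pi B) = ρ' (A ×ˢ Set.univ.pi B)) : ρ = ρ' := by
  have hgen : (Prod.instMeasurableSpace : MeasurableSpace (α × (∀ i, E i))) =
      MeasurableSpace.generateFrom (Set.image2 (· ×ˢ ·) {s : Set α | MeasurableSet s}
        (Set.univ.pi '' Set.univ.pi fun i => {s : Set (E i) | MeasurableSet s})) :=
    (generateFrom_eq_prod MeasurableSpace.generateFrom_measurableSet generateFrom_pi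
      isCountablySpanning_measurableSet
      (IsCountablySpanning.pi fun _ => isCountablySpanning_measurableSet)).symm
  refine ext_of_generate_finite _ hgen
    (MeasurableSpace.isPiSystem_measurableSet.prod isPiSystem_pi) ?_ ?_
  · rintro _ ⟨A, hA, _, ⟨B, hB, rfl⟩, rfl⟩
    exact h A B hA fun s => hB s trivial
  · have := h Set.univ (fun _ => Set.univ) MeasurableSet.univ fun _ => MeasurableSet.univ
    simpa using this

/-- The joint law of states and observations, in terms of the reference measure. -/
theorem IsPartiallyObserved.map_joint {K : Kernel (Fin M → ℝ) (Fin M → ℝ)} [IsProbabilityMeasure P]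
    (hobs : ObsAssumptions a b m S σ) (hab : a ≤ b)
    (h : IsPartiallyObserved a b m S σ K P X y) (t : ℕ) :
    P.map (fun ω => (initialPath (t + 2) X ω, initialPath (t + 1) y ω)) =
      ((P.map (initialPath (t + 2) X)).prod
        (Measure.pi fun _ => stdGaussian (EuclideanSpace ℝ (Fin N)))).withDensity
        fun p => ENNReal.ofReal (noiseWeight t p.2 * pathLikelihood a b m S σ t p) := by
  have hU := measurable_initialPath h.measurable_state (t + 2)
  have hV := measurable_initialPath h.measurable_obs (t + 1)
  have hUV := hU.prodMk hV
  have hP : IsProbabilityMeasure (P.map (initialPath (t + 2) X)) :=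
    Measure.isProbabilityMeasure_map hU.aemeasurable
  have hP2 : IsProbabilityMeasure
      (P.map (fun ω => (initialPath (t + 2) X ω, initialPath (t + 1) y ω))) :=
    Measure.isProbabilityMeasure_map hUV.aemeasurable
  set γ := stdGaussian (EuclideanSpace ℝ (Fin N))
  obtain ⟨f, hfdef⟩ : ∃ f : Fin (t + 1) → (Fin (t + 2) → Fin M → ℝ) →
      EuclideanSpace ℝ (Fin N) → ℝ≥0∞, ∀ s x v, f s x v = ENNReal.ofReal
        (Real.exp (1 / 2 * ‖v‖ ^ 2) * boxLikelihood a b m S σ s (x s.succ, v)) :=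
    ⟨_, fun _ _ _ => rfl⟩
  have hf : ∀ s, Measurable (Function.uncurry (f s)) := by
    intro s
    have := (hobs.continuous_boxLikelihood hab s).measurable
    simp only [Function.uncurry_def, hfdef]
    fun_prop
  have hdens : (fun p : (Fin (t + 2) → Fin M → ℝ) × (Fin (t + 1) → EuclideanSpace ℝ (Fin N)) =>
      ENNReal.ofReal (noiseWeight t p.2 * pathLikelihood a b m S σ t p)) =
      fun p => ∏ s, f s p.1 (p.2 s) := by
    ext p
    simp only [hfdef]
    rw [noiseWeight, pathLikelihood, ← Finset.prod_mul_distrib, ENNReal.ofReal_prod_of_nonneg]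
    exact fun s _ => mul_nonneg (Real.exp_pos _).le (hobs.boxLikelihood_pos hab s _).le
  rw [hdens]
  have key : ∀ (A : Set (Fin (t + 2) → Fin M → ℝ))
      (B : Fin (t + 1) → Set (EuclideanSpace ℝ (Fin N))), MeasurableSet A →
      (∀ s, MeasurableSet (B s)) →
      P.map (fun ω => (initialPath (t + 2) X ω, initialPath (t + 1) y ω)) (A ×ˢ Set.univ.pi B) =
      (((P.map (initialPath (t + 2) X)).prod (Measure.pi fun _ => γ)).withDensity
        fun p => ∏ s, f s p.1 (p.2 s)) (A ×ˢ Set.univ.pi B) := by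
    intro A B hA hB
    rw [Measure.map_apply hUV (hA.prod (MeasurableSet.univ_pi hB)),
      withDensity_prod_pi_apply _ γ hf hA hB, setLIntegral_map hA (Finset.measurable_prod _ fun s _ =>
        measurable_withDensity_apply (hf s) (hB s)) hU]
    let r : (ℕ → Fin M → ℝ) → Fin (t + 2) → Fin M → ℝ := fun x n => x n
    have hr : Measurable r := by fun_prop
    -- `obs_law` takes a sequence of sets over all times; beyond `t` it is padded with the whole
    -- space.
    let B' : ℕ → Set (EuclideanSpace ℝ (Fin N)) := fun s =>
      if hs : s < t + 1 then B ⟨s, hs⟩ else Set.univ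
    have hB'eq : ∀ s : Fin (t + 1), B' s = B s := fun s => dif_pos s.2
    have hB' : ∀ s, MeasurableSet (B' s) := by
      intro s
      by_cases hs : s < t + 1
      · rw [show B' s = B ⟨s, hs⟩ from dif_pos hs]
        exact hB _
      · rw [show B' s = Set.univ from dif_neg hs]
        exact MeasurableSet.univ
    have h2 := h.obs_law t (r ⁻¹' A) B' (hr hA) hB'
    have h3 : {ω | (fun n => X n ω) ∈ r ⁻¹' A} = initialPath (t + 2) X ⁻¹' A := rfl
    have h4 : {ω | (fun n => X n ω) ∈ r ⁻¹' A ∧ ∀ s ≤ t, y s ω ∈ B' s} =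
        (fun ω => (initialPath (t + 2) X ω, initialPath (t + 1) y ω)) ⁻¹'
          (A ×ˢ Set.univ.pi B) := by
      ext ω
      simp only [Set.mem_ofPred_eq, Set.mem_preimage, Set.mem_prod, Set.mem_pi, Set.mem_univ,
        true_imp_iff]
      refine and_congr (by simp only [r]; rfl) ⟨fun h s => ?_, fun h s hs => ?_⟩
      · have := h s (by omega)
        rwa [hB'eq] at this
      · have := h ⟨s, by omega⟩
        rwa [← hB'eq] at this
    rw [h3, h4] at h2
    rw [h2]
    refine lintegral_congr_ae (ae_restrict_of_ae ?_)
    -- The Gaussian densities are known only for states in the box, which holds almost surely at all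
    -- times.
    filter_upwards [ae_all_iff.2 h.state_mem] with ω hω
    rw [Finset.prod_range]
    refine Finset.prod_congr rfl fun s _ => ?_
    rw [hB'eq, hobs.multivariateGaussian_eq s (hω _)]
    congr 2
    ext v
    rw [hfdef]
    rfl
  exact ext_of_prod_pi key

end GridFilter

end JointLaws

/-! ### The filters as posterior means -/

section Filters

namespace GridFilter

variable {Ω : Type*} [MeasurableSpace Ω] {M N : ℕ} {a b : ℝ}
  {m : ℕ → (Fin M → ℝ) → EuclideanSpace ℝ (Fin N)}
  {S : ℕ → (Fin M → ℝ) → Matrix (Fin N) (Fin N) ℝ} {σ : ℝ} {P Q : Measure Ω}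
  {X : ℕ → Ω → Fin M → ℝ} {y : ℕ → Ω → EuclideanSpace ℝ (Fin N)}

theorem norm_le_of_mem_box {x : Fin M → ℝ} (hx : x ∈ box M a b) : ‖x‖ ≤ max |a| |b| :=
  (pi_norm_le_iff_of_nonneg (by positivity)).2 fun i => abs_le_max_abs_abs (hx.1 i) (hx.2 i)

/-- The posterior mean of the current state, for a prior law `ρ` of the path of states. -/
noncomputable def pathPosterior (a b : ℝ) (m : ℕ → (Fin M → ℝ) → EuclideanSpace ℝ (Fin N))
    (S : ℕ → (Fin M → ℝ) → Matrix (Fin N) (Fin N) ℝ) (σ : ℝ) (t : ℕ)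
    (ρ : Measure (Fin (t + 2) → Fin M → ℝ)) (v : Fin (t + 1) → EuclideanSpace ℝ (Fin N)) :
    Fin M → ℝ :=
  posterior ρ (pathLikelihood a b m S σ t) (fun x => x (Fin.last (t + 1))) v

theorem ObsAssumptions.stronglyMeasurable_pathPosterior (hobs : ObsAssumptions a b m S σ)
    (hab : a ≤ b) (t : ℕ) (ρ : Measure (Fin (t + 2) → Fin M → ℝ)) [SFinite ρ] :
    StronglyMeasurable (pathPosterior a b m S σ t ρ) :=
  stronglyMeasurable_posterior (hobs.continuous_pathLikelihood hab t).stronglyMeasurable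
    (continuous_apply _).stronglyMeasurable

theorem ObsAssumptions.measurable_pathPosterior_obs {Ω : Type*}
    {y : ℕ → Ω → EuclideanSpace ℝ (Fin N)} (hobs : ObsAssumptions a b m S σ)
    (hab : a ≤ b) (t : ℕ) (ρ : Measure (Fin (t + 2) → Fin M → ℝ)) [SFinite ρ] :
    Measurable[obsSigma y t] fun ω => pathPosterior a b m S σ t ρ (initialPath (t + 1) y ω) := by
  rw [obsSigma_eq_comap]
  exact (hobs.stronglyMeasurable_pathPosterior hab t ρ).measurable.comp (comap_measurable _)

/-- Path and observations are independent under `Q`, so numerator and denominator are each computed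
by freezing the observations. -/
theorem approxFilter_ae_eq_pathPosterior [IsProbabilityMeasure Q]
    (hobs : ObsAssumptions a b m S σ) (hab : a ≤ b) (hy : ∀ n, Measurable (y n)) {t : ℕ}
    {ξ : ℕ → Ω → Fin M → ℝ} (hξ : ∀ n, Measurable (ξ n))
    (hmem : ∀ n ≤ t + 1, ∀ᵐ ω ∂Q, ξ n ω ∈ box M a b)
    (hind : IndepFun (initialPath (t + 2) ξ) (initialPath (t + 1) y) Q) :
    approxFilter m S σ Q y ξ t =ᵐ[Q] fun ω =>
      pathPosterior a b m S σ t (Q.map (initialPath (t + 2) ξ)) (initialPath (t + 1) y ω) := by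
  have hU := measurable_initialPath hξ (t + 2)
  have hV := measurable_initialPath hy (t + 1)
  have hmap := hind.map_prod_eq_prod_map_map hU.aemeasurable hV.aemeasurable
  have : IsProbabilityMeasure (Q.map (initialPath (t + 2) ξ)) :=
    Measure.isProbabilityMeasure_map hU.aemeasurable
  have : IsProbabilityMeasure (Q.map (initialPath (t + 1) y)) :=
    Measure.isProbabilityMeasure_map hV.aemeasurable
  have hΛc := hobs.continuous_pathLikelihood hab t
  obtain ⟨B, hB0, hB⟩ := hobs.exists_pathLikelihood_le hab t
  have hall : ∀ᵐ ω ∂Q, ∀ n ≤ t + 1, ξ n ω ∈ box M a b := by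
    rw [ae_all_iff]
    intro n
    by_cases hn : n ≤ t + 1
    · simpa [hn] using hmem n hn
    · simp [hn]
  have hΛae : cumLikelihood m S σ y ξ t =ᵐ[Q] fun ω =>
      pathLikelihood a b m S σ t (initialPath (t + 2) ξ ω, initialPath (t + 1) y ω) := by
    filter_upwards [hall] with ω hω using cumLikelihood_eq_pathLikelihood hω
  have hΛb : ∀ p, ‖pathLikelihood a b m S σ t p‖ ≤ B := fun p => by
    rw [Real.norm_of_nonneg (hobs.pathLikelihood_pos hab t p).le]
    exact hB p
  have hlast : ∀ᵐ p ∂(Q.map (initialPath (t + 2) ξ)).prod (Q.map (initialPath (t + 1) y)),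
      ‖p.1 (Fin.last (t + 1))‖ ≤ max |a| |b| := by
    refine Measure.quasiMeasurePreserving_fst.ae
      (p := fun x : Fin (t + 2) → Fin M → ℝ => ‖x (Fin.last (t + 1))‖ ≤ max |a| |b|) ?_
    rw [ae_map_iff hU.aemeasurable
      (measurableSet_le (by fun_prop) measurable_const)]
    filter_upwards [hall] with ω hω
    exact norm_le_of_mem_box (hω _ (by simp))
  have hden := condExp_of_map_eq_prod hU hV hmap hΛc.stronglyMeasurable
    (Integrable.of_bound hΛc.aestronglyMeasurable B (Eventually.of_forall hΛb))
  have hGc : Continuous fun p : (Fin (t + 2) → Fin M → ℝ) ×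
      (Fin (t + 1) → EuclideanSpace ℝ (Fin N)) =>
      pathLikelihood a b m S σ t p • p.1 (Fin.last (t + 1)) := hΛc.smul (by fun_prop)
  have hnum := condExp_of_map_eq_prod hU hV hmap hGc.stronglyMeasurable
    (Integrable.of_bound hGc.aestronglyMeasurable (B * max |a| |b|) (by
      filter_upwards [hlast] with p hp
      rw [norm_smul]
      exact mul_le_mul (hΛb p) hp (norm_nonneg _) hB0))
  rw [← obsSigma_eq_comap] at hden hnum
  have hden' := (condExp_congr_ae (m := obsSigma y t) hΛae).trans hden
  have hnum' : Q[fun ω => cumLikelihood m S σ y ξ t ω • ξ (t + 1) ω | obsSigma y t] =ᵐ[Q] _ :=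
    (condExp_congr_ae (m := obsSigma y t) (by
      filter_upwards [hΛae] with ω hω
      rw [hω]
      rfl)).trans hnum
  filter_upwards [hden', hnum'] with ω h1 h2
  rw [approxFilter, h1, h2]
  rfl

/-- Bayes' formula for the joint law, with `noiseWeight` as the state-free weight that cancels. -/
theorem trueFilter_ae_eq_pathPosterior [IsProbabilityMeasure P]
    {K : Kernel (Fin M → ℝ) (Fin M → ℝ)} (hobs : ObsAssumptions a b m S σ) (hab : a ≤ b)
    (h : IsPartiallyObserved a b m S σ K P X y) (t : ℕ) :
    trueFilter P X y t =ᵐ[P] fun ω =>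
      pathPosterior a b m S σ t (P.map (initialPath (t + 2) X)) (initialPath (t + 1) y ω) := by
  have hU := measurable_initialPath h.measurable_state (t + 2)
  have hV := measurable_initialPath h.measurable_obs (t + 1)
  have : IsProbabilityMeasure (P.map (initialPath (t + 2) X)) :=
    Measure.isProbabilityMeasure_map hU.aemeasurable
  have hΛc := hobs.continuous_pathLikelihood hab t
  obtain ⟨B, hB0, hB⟩ := hobs.exists_pathLikelihood_le hab t
  have hΛb : ∀ p, ‖pathLikelihood a b m S σ t p‖ ≤ B := fun p => by
    rw [Real.norm_of_nonneg (hobs.pathLikelihood_pos hab t p).le]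
    exact hB p
  have hb := condExp_eq_posterior (F := Fin M → ℝ) hU hV (h.map_joint hobs hab t)
    hΛc.stronglyMeasurable
    (hobs.pathLikelihood_pos hab t) (measurable_noiseWeight t) (fun v => (noiseWeight_pos t v).le)
    (fun v => Integrable.of_bound (by fun_prop) B (Eventually.of_forall fun x => hΛb _))
    (f := fun x => x (Fin.last (t + 1))) (continuous_apply _).stronglyMeasurable
    (R := max |a| |b|) (by positivity) (by
      rw [ae_map_iff hU.aemeasurable
        (measurableSet_le (by fun_prop) measurable_const)]
      filter_upwards [h.state_mem (t + 1)] with ω hω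
      exact norm_le_of_mem_box hω)
  rw [← obsSigma_eq_comap] at hb
  exact hb

theorem recon_mulVec_basisProcess {Ω : Type*} {L : ℕ+} (Z : ℕ → Ω → Fin M → Fin L) (n : ℕ) (ω : Ω) :
    recon M a b L *ᵥ basisProcess Z n ω = fun i => recon M a b L i (Z n ω) := by
  rw [basisProcess, Matrix.mulVec_single_one]
  rfl

theorem recon_mem_box (hab : a ≤ b) (L : ℕ+) (j : Fin M → Fin L) :
    (fun i => recon M a b L i j) ∈ box M a b := by
  have hL : (0 : ℝ) < L := by exact_mod_cast L.pos
  refine ⟨fun i => ?_, fun i => ?_⟩ <;> simp only [recon, Matrix.of_apply]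
  · have : 0 ≤ ((j i : ℝ) + 1 / 2) * (b - a) / L :=
      div_nonneg (mul_nonneg (by positivity) (sub_nonneg.2 hab)) hL.le
    linarith
  · have h1 : ((j i : ℕ) : ℝ) + 1 ≤ L := by exact_mod_cast (j i).2
    have : ((j i : ℝ) + 1 / 2) * (b - a) / L ≤ b - a := by
      rw [div_le_iff₀ hL, mul_comm]
      exact mul_le_mul_of_nonneg_left (by linarith) (sub_nonneg.2 hab)
    linarith

/-- The reconstruction matrix is a continuous linear map and therefore commutes with conditional
expectation. -/
theorem chainFilter_ae_eq_approxFilter [IsFiniteMeasure Q]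
    (hobs : ObsAssumptions a b m S σ) (hab : a ≤ b) (hy : ∀ n, Measurable (y n)) {L : ℕ+}
    {Z : ℕ → Ω → Fin M → Fin L} (hZ : ∀ n, Measurable (Z n)) (t : ℕ) :
    chainFilter a b m S σ Q y Z t =ᵐ[Q]
      approxFilter m S σ Q y (fun n ω => recon M a b L *ᵥ basisProcess Z n ω) t := by
  set ξ : ℕ → Ω → Fin M → ℝ := fun n ω => recon M a b L *ᵥ basisProcess Z n ω with hξdef
  have hbas : ∀ n, Measurable (basisProcess Z n) := fun n =>
    (measurable_of_finite fun j : Fin M → Fin L => (Pi.single j 1 : (Fin M → Fin L) → ℝ)).comp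
      (hZ n)
  let A : ((Fin M → Fin L) → ℝ) →L[ℝ] (Fin M → ℝ) :=
    LinearMap.toContinuousLinearMap (recon M a b L).mulVecLin
  have hξ : ∀ n, Measurable (ξ n) := fun n => A.continuous.measurable.comp (hbas n)
  have hΛ : cumLikelihood m S σ y ξ t = fun ω =>
      pathLikelihood a b m S σ t (initialPath (t + 2) ξ ω, initialPath (t + 1) y ω) := by
    ext ω
    refine cumLikelihood_eq_pathLikelihood fun n _ => ?_
    rw [hξdef]
    simp only [recon_mulVec_basisProcess]
    exact recon_mem_box hab L _
  have hΛm : Measurable (cumLikelihood m S σ y ξ t) := by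
    rw [hΛ]
    exact (hobs.continuous_pathLikelihood hab t).measurable.comp
      ((measurable_initialPath hξ _).prodMk (measurable_initialPath hy _))
  obtain ⟨B, hB0, hB⟩ := hobs.exists_pathLikelihood_le hab t
  have hint : Integrable (fun ω => cumLikelihood m S σ y ξ t ω • basisProcess Z (t + 1) ω) Q := by
    refine Integrable.of_bound (hΛm.smul (hbas _)).aestronglyMeasurable (B * 1)
      (Eventually.of_forall fun ω => ?_)
    rw [norm_smul]
    refine mul_le_mul ?_ ?_ (norm_nonneg _) hB0
    · rw [hΛ, Real.norm_of_nonneg (hobs.pathLikelihood_pos hab t _).le]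
      exact hB _
    · rw [basisProcess, Pi.norm_single, norm_one]
  filter_upwards [A.comp_condExp_comm (m := obsSigma y t) hint] with ω hω
  have h2 : (A ∘ fun ω => cumLikelihood m S σ y ξ t ω • basisProcess Z (t + 1) ω) =
      fun ω => cumLikelihood m S σ y ξ t ω • ξ (t + 1) ω := by
    ext1 ω
    simp only [Function.comp_apply, map_smul]
    rfl
  rw [h2] at hω
  rw [approxFilter, ← hω]
  rfl

theorem chainFilter_ae_eq_pathPosterior [IsProbabilityMeasure Q]
    (hobs : ObsAssumptions a b m S σ) (hab : a ≤ b) (hy : ∀ n, Measurable (y n)) {t : ℕ} {L : ℕ+}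
    {Z : ℕ → Ω → Fin M → Fin L} (hZ : ∀ n, Measurable (Z n))
    (hind : IndepFun (initialPath (t + 2) Z) (initialPath (t + 1) y) Q) :
    chainFilter a b m S σ Q y Z t =ᵐ[Q] fun ω => pathPosterior a b m S σ t
      (Q.map (initialPath (t + 2) fun n ω i => recon M a b L i (Z n ω)))
      (initialPath (t + 1) y ω) := by
  have h1 := chainFilter_ae_eq_approxFilter (Q := Q) hobs hab hy hZ t
  simp only [recon_mulVec_basisProcess] at h1
  have hcol : Measurable fun (j : Fin M → Fin L) (i : Fin M) => recon M a b L i j :=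
    measurable_of_finite _
  refine h1.trans (approxFilter_ae_eq_pathPosterior hobs hab hy (fun n => hcol.comp (hZ n))
    (fun n _ => Eventually.of_forall fun ω => recon_mem_box hab L _) ?_)
  exact hind.comp (φ := fun (z : Fin (t + 2) → Fin M → Fin L) n i => recon M a b L i (z n))
    (measurable_pi_lambda _ fun n => hcol.comp (measurable_pi_apply n)) measurable_id

/-- Absolute continuity of `P` with respect to `Q` on the whole of `Ω` is not available. But the
coincidence set is an event of the observations, and their law under `P` is absolutely continuous
with respect to white noise, their law under `Q`. -/
theorem ae_eq_of_ae_eq_reference [IsProbabilityMeasure P] [IsProbabilityMeasure Q]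
    {K : Kernel (Fin M → ℝ) (Fin M → ℝ)} (hobs : ObsAssumptions a b m S σ) (hab : a ≤ b)
    (h : IsPartiallyObserved a b m S σ K P X y) {t : ℕ} (hQ : IsReferenceMeasure t X y P Q)
    {f g : Ω → Fin M → ℝ} (hf : Measurable[obsSigma y t] f) (hg : Measurable[obsSigma y t] g)
    (hfg : f =ᵐ[Q] g) : f =ᵐ[P] g := by
  have hU := measurable_initialPath h.measurable_state (t + 2)
  have hV := measurable_initialPath h.measurable_obs (t + 1)
  have hs : MeasurableSet[obsSigma y t] {ω | f ω = g ω} :=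
    measurableSet_eq_fun (m := obsSigma y t) hf hg
  rw [obsSigma_eq_comap] at hs
  obtain ⟨B, hB, hBeq⟩ := hs
  have h1 : ∀ᵐ v ∂(Q.map (initialPath (t + 1) y)), v ∈ B := by
    refine (mem_ae_map_iff hV.aemeasurable hB).2 ?_
    filter_upwards [hfg] with ω hω
    have : ω ∈ initialPath (t + 1) y ⁻¹' B := by rw [hBeq]; exact hω
    exact this
  rw [hQ.map_initialPath_obs h.measurable_obs] at h1
  have h2 : ∀ᵐ p ∂P.map (fun ω => (initialPath (t + 2) X ω, initialPath (t + 1) y ω)),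
      p.2 ∈ B := by
    rw [h.map_joint hobs hab t]
    exact (withDensity_absolutelyContinuous _ _).ae_le (Measure.quasiMeasurePreserving_snd.ae h1)
  have h3 := ae_of_ae_map (hU.prodMk hV).aemeasurable h2
  filter_upwards [h3] with ω hω
  have : ω ∈ {ω | f ω = g ω} := by rw [← hBeq]; exact hω
  exact this

theorem measurable_approxFilter (ξ : ℕ → Ω → Fin M → ℝ) (t : ℕ) :
    Measurable[obsSigma y t] (approxFilter m S σ Q y ξ t) := by
  have h1 : Measurable[obsSigma y t] (Q[cumLikelihood m S σ y ξ t | obsSigma y t]) :=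
    stronglyMeasurable_condExp.measurable
  have h2 : Measurable[obsSigma y t]
      (Q[fun ω' => cumLikelihood m S σ y ξ t ω' • ξ (t + 1) ω' | obsSigma y t]) :=
    stronglyMeasurable_condExp.measurable
  exact h1.inv.smul h2

theorem measurable_chainFilter {L : ℕ+} (Z : ℕ → Ω → Fin M → Fin L) (t : ℕ) :
    Measurable[obsSigma y t] (chainFilter a b m S σ Q y Z t) := by
  have h : Continuous fun v : (Fin M → Fin L) → ℝ => recon M a b L *ᵥ v := by fun_prop
  have h1 : Measurable[obsSigma y t] (Q[cumLikelihood m S σ y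
      (fun n ω' => recon M a b L *ᵥ basisProcess Z n ω') t | obsSigma y t]) :=
    stronglyMeasurable_condExp.measurable
  have h2 : Measurable[obsSigma y t] (Q[fun ω' => cumLikelihood m S σ y
      (fun n ω' => recon M a b L *ᵥ basisProcess Z n ω') t ω' • basisProcess Z (t + 1) ω' |
        obsSigma y t]) :=
    stronglyMeasurable_condExp.measurable
  exact h1.inv.smul (h.measurable.comp h2)

end GridFilter

end Filters

/-! ### Cells of the uniform partition -/

section Cells

namespace GridFilter

variable {M : ℕ} {a b : ℝ} {L : ℕ+} {I : Fin L → Set ℝ}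

/-- Each interval is its interior together with some of its two endpoints. -/
theorem IsUniformPartition.measurableSet (h : IsUniformPartition a b L I) (l : Fin L) :
    MeasurableSet (I l) := by
  set c := a + (l : ℝ) * (b - a) / L
  set d := a + ((l : ℝ) + 1) * (b - a) / L
  have h1 : I l = Set.Ioo c d ∪ (I l \ Set.Ioo c d) :=
    (Set.union_sdiff_cancel (h.Ioo_subset l)).symm
  have h2 : I l \ Set.Ioo c d ⊆ {c, d} := by
    rintro x ⟨hx, hx'⟩
    have hx2 := h.subset_Icc l hx
    rw [Set.mem_Ioo, not_and_or, not_lt, not_lt] at hx'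
    rcases hx' with h3 | h3
    · exact Or.inl (le_antisymm h3 hx2.1)
    · exact Or.inr (le_antisymm hx2.2 h3)
  rw [h1]
  exact measurableSet_Ioo.union ((Set.toFinite {c, d}).subset h2).measurableSet

theorem IsUniformPartition.measurableSet_cell (h : IsUniformPartition a b L I)
    (j : Fin M → Fin L) : MeasurableSet (cell I j) := by
  have : cell I j = Set.univ.pi fun i => I (j i) := by
    ext x
    simp [cell]
  rw [this]
  exact MeasurableSet.univ_pi fun i => h.measurableSet _

theorem IsUniformPartition.eq_of_mem_cell (h : IsUniformPartition a b L I) {x : Fin M → ℝ}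
    {j j' : Fin M → Fin L} (hj : x ∈ cell I j) (hj' : x ∈ cell I j') : j = j' := by
  ext1 i
  by_contra hne
  exact Set.disjoint_left.1 (h.disjoint hne) (hj i) (hj' i)

theorem IsUniformPartition.exists_mem_cell (h : IsUniformPartition a b L I) {x : Fin M → ℝ}
    (hx : x ∈ box M a b) : ∃ j, x ∈ cell I j := by
  have h1 : ∀ i, ∃ l, x i ∈ I l := fun i => by
    have : x i ∈ ⋃ l, I l := by
      rw [h.iUnion_eq]
      exact ⟨hx.1 i, hx.2 i⟩
    simpa using this
  choose j hj using h1
  exact ⟨j, hj⟩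

open Classical in
/-- The index of the cell of a point; arbitrary outside of `[a,b]^M`. -/
noncomputable def cellIndex (I : Fin L → Set ℝ) (x : Fin M → ℝ) : Fin M → Fin L :=
  if h : ∃ j, x ∈ cell I j then h.choose else fun _ => ⟨0, L.pos⟩

theorem IsUniformPartition.cellIndex_eq (h : IsUniformPartition a b L I) {x : Fin M → ℝ}
    {j : Fin M → Fin L} (hj : x ∈ cell I j) : cellIndex I x = j := by
  have hex : ∃ j, x ∈ cell I j := ⟨j, hj⟩
  rw [cellIndex, dif_pos hex]
  exact h.eq_of_mem_cell hex.choose_spec hj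

theorem IsUniformPartition.mem_cell_cellIndex (h : IsUniformPartition a b L I) {x : Fin M → ℝ}
    (hx : x ∈ box M a b) : x ∈ cell I (cellIndex I x) := by
  obtain ⟨j, hj⟩ := h.exists_mem_cell hx
  rwa [h.cellIndex_eq hj]

theorem IsUniformPartition.cellIndex_eq_iff (h : IsUniformPartition a b L I) {x : Fin M → ℝ}
    (hx : x ∈ box M a b) {j : Fin M → Fin L} : cellIndex I x = j ↔ x ∈ cell I j :=
  ⟨fun e => e ▸ h.mem_cell_cellIndex hx, h.cellIndex_eq⟩

theorem IsUniformPartition.measurable_cellIndex (h : IsUniformPartition a b L I) :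
    Measurable (cellIndex I : (Fin M → ℝ) → Fin M → Fin L) := by
  refine measurable_to_countable' fun j => ?_
  have hU : MeasurableSet (⋃ j : Fin M → Fin L, cell I j) :=
    MeasurableSet.iUnion h.measurableSet_cell
  -- The default index also collects every point outside all cells, so its preimage is larger than
  -- its cell.
  by_cases hj : j = fun _ => ⟨0, L.pos⟩
  · have : cellIndex I ⁻¹' {j} = cell I j ∪ (⋃ j : Fin M → Fin L, cell I j)ᶜ := by
      ext x
      constructor
      · intro hx
        by_cases hex : ∃ j, x ∈ cell I j
        · obtain ⟨j', hj'⟩ := hex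
          left
          have : cellIndex I x = j := hx
          rw [h.cellIndex_eq hj'] at this
          exact this ▸ hj'
        · right
          simpa using hex
      · rintro (hx | hx)
        · exact h.cellIndex_eq hx
        · have hex : ¬ ∃ j, x ∈ cell I j := by simpa using hx
          rw [Set.mem_preimage, cellIndex, dif_neg hex, hj]
          rfl
    rw [this]
    exact (h.measurableSet_cell j).union hU.compl
  · have : cellIndex I ⁻¹' {j} = cell I j := by
      ext x
      refine ⟨fun hx => ?_, h.cellIndex_eq⟩
      have hx' : cellIndex I x = j := hx
      by_cases hex : ∃ j, x ∈ cell I j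
      · obtain ⟨j', hj'⟩ := hex
        rw [h.cellIndex_eq hj'] at hx'
        exact hx' ▸ hj'
      · rw [cellIndex, dif_neg hex] at hx'
        exact absurd hx'.symm hj
    rw [this]
    exact h.measurableSet_cell j

theorem IsUniformPartition.basisQuantizer_eq (h : IsUniformPartition a b L I) {x : Fin M → ℝ}
    (hx : x ∈ box M a b) : basisQuantizer I x = Pi.single (cellIndex I x) 1 := by
  ext j
  by_cases hj : j = cellIndex I x
  · subst hj
    rw [basisQuantizer, Set.indicator_of_mem (h.mem_cell_cellIndex hx), Pi.single_eq_same]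
  · rw [basisQuantizer, Pi.single_eq_of_ne hj, Set.indicator_of_notMem]
    exact fun hx' => hj (h.cellIndex_eq hx').symm

theorem IsUniformPartition.quantizer_eq (h : IsUniformPartition a b L I) {x : Fin M → ℝ}
    (hx : x ∈ box M a b) : quantizer a b I x = fun i => recon M a b L i (cellIndex I x) := by
  rw [quantizer, h.basisQuantizer_eq hx, Matrix.mulVec_single_one]
  rfl

theorem IsUniformPartition.norm_sub_quantizer_le (h : IsUniformPartition a b L I) (hab : a ≤ b)
    {x : Fin M → ℝ} (hx : x ∈ box M a b) : ‖quantizer a b I x - x‖ ≤ (b - a) / L := by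
  have hL : (0 : ℝ) < L := by exact_mod_cast L.pos
  have hw : 0 ≤ (b - a) / L := div_nonneg (sub_nonneg.2 hab) hL.le
  rw [h.quantizer_eq hx, pi_norm_le_iff_of_nonneg hw]
  intro i
  have h1 := h.subset_Icc _ (h.mem_cell_cellIndex hx i)
  rw [Set.mem_Icc] at h1
  simp only [recon, Matrix.of_apply, Pi.sub_apply, Real.norm_eq_abs]
  rw [mul_div_assoc] at h1 ⊢
  rw [mul_div_assoc] at h1
  rw [abs_le]
  constructor <;> nlinarith [h1.1, h1.2]

theorem IsUniformPartition.measurable_quantizer (h : IsUniformPartition a b L I) :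
    Measurable (quantizer a b I : (Fin M → ℝ) → Fin M → ℝ) := by
  have h1 : Continuous fun v : (Fin M → Fin L) → ℝ => recon M a b L *ᵥ v := by fun_prop
  refine h1.measurable.comp (measurable_pi_lambda _ fun j => ?_)
  exact measurable_const.indicator (h.measurableSet_cell j)

theorem IsUniformPartition.volume_cell_le (h : IsUniformPartition a b L I) (hab : a ≤ b)
    (j : Fin M → Fin L) : volume (cell I j) ≤ ENNReal.ofReal (((b - a) / L) ^ M) := by
  have hL : (0 : ℝ) < L := by exact_mod_cast L.pos
  have h1 : cell I j ⊆ Set.Icc (fun i => a + (j i : ℝ) * (b - a) / L)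
      (fun i => a + ((j i : ℝ) + 1) * (b - a) / L) := fun x hx =>
    ⟨fun i => (h.subset_Icc _ (hx i)).1, fun i => (h.subset_Icc _ (hx i)).2⟩
  refine (measure_mono h1).trans (le_of_eq ?_)
  rw [Real.volume_Icc_pi]
  have h2 : ∀ i, a + ((j i : ℝ) + 1) * (b - a) / L - (a + (j i : ℝ) * (b - a) / L) =
      (b - a) / L := fun i => by ring
  simp only [h2]
  rw [Finset.prod_const, Finset.card_univ, Fintype.card_fin,
    ENNReal.ofReal_pow (div_nonneg (sub_nonneg.2 hab) hL.le)]

end GridFilter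

end Cells

/-! ### Conditional regularity in the mean -/

section Regularity

namespace GridFilter

variable {M : ℕ} {a b : ℝ} {I : (L : ℕ+) → Fin L → Set ℝ}
  {K : Kernel (Fin M → ℝ) (Fin M → ℝ)} {ν : Measure (Fin M → ℝ)}

/-- The `ℓ₁`-distance, over all cells, between the kernel and the cumulative kernel. -/
noncomputable def kernelDefect (J : (L : ℕ+) → Fin L → Set ℝ)
    (K : Kernel (Fin M → ℝ) (Fin M → ℝ)) (ν : Measure (Fin M → ℝ)) (L : ℕ+) (x : Fin M → ℝ) : ℝ :=
  ∑ i : Fin M → Fin L, |(K x).real (cell (J L) i) -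
    cumKernel K ν (cell (J L) i) (cell (J L) (cellIndex (J L) x))|

theorem measurable_kernelDefect (hI : ∀ L, IsUniformPartition a b L (I L)) (L : ℕ+) :
    Measurable (kernelDefect I K ν L) := by
  refine Finset.measurable_sum _ fun i _ => (Measurable.sub ?_ ?_).abs
  · exact (K.measurable_coe ((hI L).measurableSet_cell i)).ennreal_toReal
  · exact (measurable_of_finite fun j => cumKernel K ν (cell (I L) i) (cell (I L) j)).comp
      (hI L).measurable_cellIndex

theorem card_cellIndices (L : ℕ+) : (Fintype.card (Fin M → Fin L) : ℝ) = ((L ^ M : ℕ+) : ℝ) := by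
  simp

/-- There are L^M cells, each contributing at most δ/L^M, so the constant is 1. -/
theorem CRT1.kernelDefect_le (hI : ∀ L, IsUniformPartition a b L (I L))
    (hbox : ∀ᵐ x ∂ν, x ∈ box M a b) (h : CRT1 I K ν) :
    ∃ δ, IsVanishingUI ν δ ∧ ∃ c : ℝ, 0 ≤ c ∧
      ∀ᵐ x ∂ν, ∀ L, kernelDefect I K ν L x ≤ c * δ (L ^ M) x := by
  obtain ⟨δ, hδ, hK⟩ := h
  refine ⟨δ, hδ, 1, zero_le_one, ?_⟩
  filter_upwards [hK, hbox] with x hx hxb L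
  have hpos : (0 : ℝ) < ((L ^ M : ℕ+) : ℝ) := by exact_mod_cast (L ^ M).pos
  calc kernelDefect I K ν L x
      ≤ ∑ _i : Fin M → Fin L, δ (L ^ M) x / ((L ^ M : ℕ+) : ℝ) :=
        Finset.sum_le_sum fun i _ => hx L _ ((hI L).mem_cell_cellIndex hxb) i
    _ = 1 * δ (L ^ M) x := by
        rw [Finset.sum_const, nsmul_eq_mul, Finset.card_univ, card_cellIndices, one_mul]
        field_simp

theorem integrableOn_density [IsMarkovKernel K] {κ : (Fin M → ℝ) → (Fin M → ℝ) → ℝ}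
    (hκ : Measurable (Function.uncurry κ)) {x : Fin M → ℝ}
    (hx : K x = volume.withDensity (fun v => ENNReal.ofReal (κ x v))) (hpos : ∀ v, 0 ≤ κ x v)
    {A : Set (Fin M → ℝ)} (hA : MeasurableSet A) :
    IntegrableOn (κ x) A ∧ (K x).real A = ∫ v in A, κ x v := by
  have hm : Measurable (κ x) := hκ.comp measurable_prodMk_left
  have hKA : K x A = ∫⁻ v in A, ENNReal.ofReal (κ x v) := by rw [hx, withDensity_apply _ hA]
  refine ⟨⟨hm.aestronglyMeasurable, ?_⟩, ?_⟩
  · rw [hasFiniteIntegral_iff_ofReal (Eventually.of_forall hpos), ← hKA]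
    exact measure_lt_top _ _
  · rw [integral_eq_lintegral_of_nonneg_ae (Eventually.of_forall hpos) hm.aestronglyMeasurable,
      ← hKA, measureReal_def]

/-- Fubini on `E × A`; the joint integrability holds because the kernel has mass at most 1 and `ν E`
is finite. -/
theorem setIntegral_cumDensity [IsMarkovKernel K] [IsFiniteMeasure ν]
    {κ : (Fin M → ℝ) → (Fin M → ℝ) → ℝ}
    (hκ : Measurable (Function.uncurry κ)) (hpos : ∀ x v, 0 ≤ κ x v)
    (hK : ∀ᵐ x ∂ν, K x = volume.withDensity (fun v => ENNReal.ofReal (κ x v)))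
    {A : Set (Fin M → ℝ)} (hA : MeasurableSet A) (E : Set (Fin M → ℝ)) :
    IntegrableOn (fun v => cumDensity κ ν v E) A ∧
      cumKernel K ν A E = ∫ v in A, cumDensity κ ν v E := by
  have hint : Integrable (Function.uncurry κ) ((ν.restrict E).prod (volume.restrict A)) := by
    refine ⟨hκ.aestronglyMeasurable, ?_⟩
    rw [hasFiniteIntegral_iff_ofReal (f := Function.uncurry κ)
        (Eventually.of_forall fun p => hpos p.1 p.2),
      lintegral_prod _ hκ.ennreal_ofReal.aemeasurable]
    have : ∫⁻ x in E, ∫⁻ v in A, ENNReal.ofReal (κ x v) ∂volume ∂ν = ∫⁻ x in E, K x A ∂ν := by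
      refine lintegral_congr_ae (ae_restrict_of_ae ?_)
      filter_upwards [hK] with x hx
      rw [hx, withDensity_apply _ hA]
    refine this.trans_lt ?_
    calc ∫⁻ x in E, K x A ∂ν ≤ ∫⁻ _ in E, 1 ∂ν := lintegral_mono fun x => prob_le_one
      _ = ν E := by simp
      _ < ∞ := measure_lt_top _ _
  refine ⟨hint.integral_prod_right.div_const _, ?_⟩
  unfold cumKernel cumDensity
  rw [integral_div, integral_integral_swap (f := fun v θ => κ θ v) hint.swap]
  congr 1
  refine integral_congr_ae (ae_restrict_of_ae ?_)
  filter_upwards [hK] with x hx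
  exact (integrableOn_density hκ hx (hpos x) hA).2

/-- On a cell of volume at most ((b-a)/L)^M the densities differ by at most δ; summing over L^M
cells gives the constant (b-a)^M. -/
theorem CRT2.kernelDefect_le [IsMarkovKernel K] [IsFiniteMeasure ν] (hab : a ≤ b)
    (hI : ∀ L, IsUniformPartition a b L (I L))
    (hbox : ∀ᵐ x ∂ν, x ∈ box M a b) (h : CRT2 I K ν) :
    ∃ δ, IsVanishingUI ν δ ∧ ∃ c : ℝ, 0 ≤ c ∧
      ∀ᵐ x ∂ν, ∀ L, kernelDefect I K ν L x ≤ c * δ (L ^ M) x := by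
  obtain ⟨κ, hκ, hpos, hK, δ, hδ, hle⟩ := h
  refine ⟨δ, hδ, (b - a) ^ M, pow_nonneg (sub_nonneg.2 hab) _, ?_⟩
  filter_upwards [hle, hK, hbox] with x hx hKx hxb L
  have hL : (0 : ℝ) < L := by exact_mod_cast L.pos
  have hw : 0 ≤ ((b - a) / L) ^ M := pow_nonneg (div_nonneg (sub_nonneg.2 hab) hL.le) _
  have hpt := hx L _ ((hI L).mem_cell_cellIndex hxb)
  calc kernelDefect I K ν L x
      ≤ ∑ _i : Fin M → Fin L, δ (L ^ M) x * ((b - a) / L) ^ M := by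
        refine Finset.sum_le_sum fun i _ => ?_
        have hA := (hI L).measurableSet_cell i
        have hvol := (hI L).volume_cell_le hab i
        obtain ⟨i1, e1⟩ := integrableOn_density hκ hKx (hpos x) hA
        obtain ⟨i2, e2⟩ := setIntegral_cumDensity hκ hpos hK hA
          (cell (I L) (cellIndex (I L) x))
        rw [e1, e2, ← integral_sub i1 i2, ← Real.norm_eq_abs]
        refine (norm_setIntegral_le_of_norm_le_const_ae (hvol.trans_lt ENNReal.ofReal_lt_top)
          (ae_restrict_of_ae hpt)).trans ?_
        refine mul_le_mul_of_nonneg_left ?_ (hδ.nonneg _ _)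
        exact ENNReal.toReal_le_of_le_ofReal hw hvol
    _ = (b - a) ^ M * δ (L ^ M) x := by
        rw [Finset.sum_const, nsmul_eq_mul, Finset.card_univ, card_cellIndices, div_pow]
        have : ((L ^ M : ℕ+) : ℝ) = (L : ℝ) ^ M := by simp
        rw [this]
        field_simp

/-- Vitali's theorem gives convergence in L¹, and the functions are nonnegative. The positive
indices are relabelled by `ℕ`, where that theorem is applied. -/
theorem IsVanishingUI.tendsto_integral [IsFiniteMeasure ν] {δ : ℕ+ → (Fin M → ℝ) → ℝ}
    (h : IsVanishingUI ν δ) : Tendsto (fun n => ∫ x, δ n x ∂ν) atTop (𝓝 0) := by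
  let e := OrderIso.pnatIsoNat
  have hi : ∀ n, MemLp (δ n) 1 ν := h.uniformIntegrable.memLp
  have h1 : Tendsto (fun n => eLpNorm (δ (e.symm n) - fun _ => (0 : ℝ)) 1 ν) atTop (𝓝 0) := by
    refine tendsto_Lp_finite_of_tendsto_ae le_rfl ENNReal.one_ne_top (fun n => (hi _).1)
      (memLp_const 0) (fun ε hε => ?_) ?_
    · obtain ⟨η, hη, hle⟩ := h.uniformIntegrable.unifIntegrable hε
      exact ⟨η, hη, fun n => hle (e.symm n)⟩
    · filter_upwards [h.tendsto] with x hx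
      exact hx.comp e.symm.tendsto_atTop
  have h2 : Tendsto (fun n => eLpNorm (δ n) 1 ν) atTop (𝓝 0) := by
    have := h1.comp e.tendsto_atTop
    refine this.congr fun n => ?_
    simp only [Function.comp_apply, OrderIso.symm_apply_apply]
    congr 1
    ext x
    simp
  have h3 := (ENNReal.tendsto_toReal ENNReal.zero_ne_top).comp h2
  rw [ENNReal.toReal_zero] at h3
  refine h3.congr fun n => ?_
  rw [Function.comp_apply, eLpNorm_one_eq_lintegral_enorm,
    ← integral_norm_eq_lintegral_enorm (hi n).1]
  exact integral_congr_ae (Eventually.of_forall fun x => Real.norm_of_nonneg (h.nonneg n x))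

/-- The kernel of a conditionally regular state is close to the cumulative kernel in the mean. -/
theorem ConditionallyRegular.tendsto_integral_kernelDefect [IsMarkovKernel K] [IsFiniteMeasure ν]
    (hM : M ≠ 0) (hab : a ≤ b) (hI : ∀ L, IsUniformPartition a b L (I L))
    (hbox : ∀ᵐ x ∂ν, x ∈ box M a b) (h : ConditionallyRegular I K ν) :
    (∀ L, Integrable (kernelDefect I K ν L) ν) ∧
      Tendsto (fun L => ∫ x, kernelDefect I K ν L x ∂ν) atTop (𝓝 0) := by
  obtain ⟨δ, hδ, c, hc, hle⟩ : ∃ δ, IsVanishingUI ν δ ∧ ∃ c : ℝ, 0 ≤ c ∧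
      ∀ᵐ x ∂ν, ∀ L, kernelDefect I K ν L x ≤ c * δ (L ^ M) x :=
    h.elim (fun h => h.kernelDefect_le hI hbox) fun h => h.kernelDefect_le hab hI hbox
  have hδi : ∀ n, Integrable (δ n) ν := fun n =>
    memLp_one_iff_integrable.1 (hδ.uniformIntegrable.memLp n)
  have h0 : ∀ L x, 0 ≤ kernelDefect I K ν L x := fun L x =>
    Finset.sum_nonneg fun i _ => abs_nonneg _
  have hint : ∀ L, Integrable (kernelDefect I K ν L) ν := fun L => by
    refine ((hδi (L ^ M)).const_mul c).mono' (measurable_kernelDefect hI L).aestronglyMeasurable ?_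
    filter_upwards [hle] with x hx
    rw [Real.norm_of_nonneg (h0 L x)]
    exact hx L
  refine ⟨hint, ?_⟩
  -- The regularity bounds are indexed by the number of cells L^M, which grows with L only for M ≠
  -- 0.
  have hpow : Tendsto (fun L : ℕ+ => L ^ M) atTop atTop := by
    refine tendsto_atTop_mono (fun L => ?_) tendsto_id
    exact le_self_pow (one_le) hM
  have hlim := (hδ.tendsto_integral.comp hpow).const_mul c
  rw [mul_zero] at hlim
  refine squeeze_zero (fun L => integral_nonneg (h0 L)) (fun L => ?_) hlim
  rw [Function.comp_apply, ← integral_const_mul]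
  refine integral_mono_ae (hint L) ((hδi _).const_mul c) ?_
  filter_upwards [hle] with x hx using hx L

end GridFilter

end Regularity

/-! ### Path laws of the marginal quantization and of the chain -/

section PathLaws

namespace GridFilter

/-- Masses of paths that almost follow a transition matrix are close to those that do follow it. -/
theorem sum_abs_sub_le_of_transition {J : Type*} [Fintype J] {p q : ∀ n, (Fin (n + 1) → J) → ℝ}
    {A : J → J → ℝ} {ε : ℝ} {T : ℕ} (h0 : ∀ z, p 0 z = q 0 z) (hA0 : ∀ i j, 0 ≤ A i j)
    (hA : ∀ j, ∑ i, A i j ≤ 1)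
    (hq : ∀ n ≤ T, ∀ z i, q (n + 1) (Fin.snoc (α := fun _ => J) z i) = A i (z (Fin.last n)) * q n z)
    (hp : ∀ n, ∑ z, ∑ i, |p (n + 1) (Fin.snoc (α := fun _ => J) z i) -
      A i (z (Fin.last n)) * p n z| ≤ ε) :
    ∀ n ≤ T + 1, ∑ z, |p n z - q n z| ≤ n * ε := by
  intro n
  induction n with
  | zero => simp [h0]
  | succ n ih =>
    intro hn
    have h1 : ∑ z, |p (n + 1) z - q (n + 1) z| = ∑ z, ∑ i,
        |p (n + 1) (Fin.snoc (α := fun _ => J) z i) -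
          q (n + 1) (Fin.snoc (α := fun _ => J) z i)| := by
      rw [← (Fin.snocEquiv fun _ => J).sum_comp, Fintype.sum_prod_type_right]
      rfl
    -- Columns of `A` sum to at most 1, so the error inherited from step `n` does not grow.
    have h2 : ∀ z : Fin (n + 1) → J, ∑ i, |A i (z (Fin.last n)) * p n z -
        A i (z (Fin.last n)) * q n z| ≤ |p n z - q n z| := fun z => by
      calc ∑ i, |A i (z (Fin.last n)) * p n z - A i (z (Fin.last n)) * q n z|
          = (∑ i, A i (z (Fin.last n))) * |p n z - q n z| := by
            rw [Finset.sum_mul]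
            refine Finset.sum_congr rfl fun i _ => ?_
            rw [← mul_sub, abs_mul, abs_of_nonneg (hA0 _ _)]
        _ ≤ 1 * |p n z - q n z| := mul_le_mul_of_nonneg_right (hA _) (abs_nonneg _)
        _ = _ := one_mul _
    calc ∑ z, |p (n + 1) z - q (n + 1) z|
        ≤ ∑ z, ∑ i, (|p (n + 1) (Fin.snoc (α := fun _ => J) z i) - A i (z (Fin.last n)) * p n z| +
            |A i (z (Fin.last n)) * p n z - A i (z (Fin.last n)) * q n z|) := by
          rw [h1]
          refine Finset.sum_le_sum fun z _ => Finset.sum_le_sum fun i _ => ?_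
          rw [hq n (by omega)]
          exact abs_sub_le _ _ _
      _ ≤ ε + n * ε := by
          simp only [Finset.sum_add_distrib]
          exact add_le_add (hp n) ((Finset.sum_le_sum fun z _ => h2 z).trans (ih (by omega)))
      _ = ((n + 1 : ℕ) : ℝ) * ε := by push_cast; ring

variable {Ω : Type*} [MeasurableSpace Ω] {M N : ℕ} {a b : ℝ}
  {m : ℕ → (Fin M → ℝ) → EuclideanSpace ℝ (Fin N)}
  {S : ℕ → (Fin M → ℝ) → Matrix (Fin N) (Fin N) ℝ} {σ : ℝ}
  {K : Kernel (Fin M → ℝ) (Fin M → ℝ)} {P Q : Measure Ω}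
  {X : ℕ → Ω → Fin M → ℝ} {y : ℕ → Ω → EuclideanSpace ℝ (Fin N)}

/-- The Markov property integrated over an event of the past. -/
theorem IsPartiallyObserved.real_inter_preimage [IsMarkovKernel K] [IsProbabilityMeasure P]
    (h : IsPartiallyObserved a b m S σ K P X y) (n : ℕ) {s : Set Ω}
    (hs : MeasurableSet[stateSigma X n] s) {A : Set (Fin M → ℝ)} (hA : MeasurableSet A) :
    P.real (s ∩ X (n + 1) ⁻¹' A) = ∫ ω in s, (K (X n ω)).real A ∂P := by
  have hle : stateSigma X n ≤ ‹MeasurableSpace Ω› := iSup₂_le fun k _ => (h.measurable_state k).comap_le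
  have hX := h.measurable_state (n + 1) hA
  have hint : Integrable ((X (n + 1) ⁻¹' A).indicator fun _ => (1 : ℝ)) P :=
    (integrable_const 1).indicator hX
  rw [← setIntegral_congr_ae (hle _ hs) ((h.markov n A hA).mono fun ω hω _ => hω),
    setIntegral_condExp hle hint hs, setIntegral_indicator hX]
  simp

theorem IsPartiallyObserved.integrable_kernel [IsMarkovKernel K] [IsFiniteMeasure P]
    (h : IsPartiallyObserved a b m S σ K P X y) (n : ℕ) {A : Set (Fin M → ℝ)}
    (hA : MeasurableSet A) : Integrable (fun ω => (K (X n ω)).real A) P := by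
  refine Integrable.of_bound ((K.measurable_coe hA).ennreal_toReal.comp
    (h.measurable_state n)).aestronglyMeasurable 1 (Eventually.of_forall fun ω => ?_)
  rw [Real.norm_of_nonneg measureReal_nonneg]
  exact measureReal_le_one

/-- Invariance is assumed only for the initial law; the integrated Markov property propagates it to
all times. -/
theorem IsPartiallyObserved.map_state_eq [IsMarkovKernel K] [IsProbabilityMeasure P]
    (h : IsPartiallyObserved a b m S σ K P X y) (n : ℕ) : P.map (X n) = P.map (X 0) := by
  induction n with
  | zero => rfl
  | succ n ih =>
    have hX := h.measurable_state n
    have hX' := h.measurable_state (n + 1)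
    have : IsProbabilityMeasure (P.map (X n)) := Measure.isProbabilityMeasure_map hX.aemeasurable
    have : IsProbabilityMeasure (P.map (X (n + 1))) :=
      Measure.isProbabilityMeasure_map hX'.aemeasurable
    rw [← h.invariant.def, ← ih]
    ext A hA
    have hK := K.measurable_coe hA
    have h1 := h.real_inter_preimage n (s := Set.univ) MeasurableSet.univ hA
    rw [Set.univ_inter, setIntegral_univ] at h1
    rw [Measure.bind_apply hA K.measurable.aemeasurable, Measure.map_apply hX' hA,
      lintegral_map hK hX]
    have h2 : ∫ ω, (K (X n ω)).real A ∂P = (∫⁻ ω, K (X n ω) A ∂P).toReal :=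
      integral_toReal (hK.comp hX).aemeasurable (Eventually.of_forall fun ω => measure_lt_top _ _)
    rw [h2, measureReal_def] at h1
    refine (ENNReal.toReal_eq_toReal_iff' (measure_ne_top _ _) ?_).1 h1
    exact (lt_of_le_of_lt (lintegral_mono (g := fun _ => 1) fun ω => prob_le_one) (by simp)).ne

/-- This connects the matrix driving the chain with the averaged kernel in conditional regularity.
For a null cell both sides are zero by convention. -/
theorem IsPartiallyObserved.transitionMatrix_eq_cumKernel [IsMarkovKernel K]
    [IsProbabilityMeasure P] (h : IsPartiallyObserved a b m S σ K P X y) {L : ℕ+}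
    {I : Fin L → Set ℝ} (hI : IsUniformPartition a b L I) (i j : Fin M → Fin L) :
    transitionMatrix P X I i j = cumKernel K (P.map (X 0)) (cell I i) (cell I j) := by
  have hX := h.measurable_state 0
  have hj := hI.measurableSet_cell j
  have hs : MeasurableSet[stateSigma X 0] (X 0 ⁻¹' cell I j) :=
    le_iSup₂ (f := fun k (_ : k ≤ 0) => MeasurableSpace.comap (X k) inferInstance) 0 le_rfl _
      ⟨_, hj, rfl⟩
  rw [transitionMatrix, Matrix.of_apply, cumKernel, measureReal_def,
    cond_apply (hX hj), ENNReal.toReal_mul, ENNReal.toReal_inv, ← measureReal_def,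
    ← measureReal_def, h.real_inter_preimage 0 hs (hI.measurableSet_cell i),
    map_measureReal_apply hX hj, setIntegral_map (f := fun θ => (K θ).real (cell I i)) hj
      ((K.measurable_coe (hI.measurableSet_cell i)).ennreal_toReal).aestronglyMeasurable
      hX.aemeasurable, div_eq_inv_mul]

/-- Cells are disjoint. The sum may be 0 rather than 1, since conditioning on a null cell yields the
zero measure. -/
theorem IsUniformPartition.sum_transitionMatrix_le [IsProbabilityMeasure P] {L : ℕ+}
    {I : Fin L → Set ℝ} (hI : IsUniformPartition a b L I) (hX : Measurable (X 1))
    (j : Fin M → Fin L) : ∑ i, transitionMatrix P X I i j ≤ 1 := by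
  set μ := P[|X 0 ⁻¹' cell I j] with hμ
  have hfin : IsZeroOrProbabilityMeasure μ := by rw [hμ]; infer_instance
  have hW : Measurable fun ω => cellIndex I (X 1 ω) := hI.measurable_cellIndex.comp hX
  calc ∑ i, transitionMatrix P X I i j
      ≤ ∑ i, μ.real ((fun ω => cellIndex I (X 1 ω)) ⁻¹' {i}) :=
        Finset.sum_le_sum fun i _ => measureReal_mono fun ω hω => hI.cellIndex_eq hω
    _ = μ.real Set.univ := by
        rw [← measureReal_biUnion_finset]
        · congr 1
          ext ω
          simp
        · intro i _ i' _ hne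
          exact Disjoint.preimage _ (by simpa using hne)
        · exact fun i _ => hW (measurableSet_singleton i)
    _ ≤ 1 := measureReal_le_one

theorem IsPartiallyObserved.cellIndex_ae_eq_iff [IsProbabilityMeasure P]
    (h : IsPartiallyObserved a b m S σ K P X y) {L : ℕ+} {I : Fin L → Set ℝ}
    (hI : IsUniformPartition a b L I) (n : ℕ) (j : Fin M → Fin L) :
    (X n ⁻¹' cell I j : Set Ω) =ᵐ[P] ((fun ω => cellIndex I (X n ω)) ⁻¹' {j} : Set Ω) := by
  filter_upwards [h.state_mem n] with ω hω
  exact propext (hI.cellIndex_eq_iff hω).symm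

theorem initialPath_snoc {Ω J : Type*} {n : ℕ} (W : ℕ → Ω → J) (z : Fin (n + 1) → J) (i : J) :
    initialPath (n + 2) W ⁻¹' {Fin.snoc (α := fun _ => J) z i} =
      initialPath (n + 1) W ⁻¹' {z} ∩ W (n + 1) ⁻¹' {i} := by
  ext ω
  simp only [Set.mem_preimage, Set.mem_singleton_iff, Set.mem_inter_iff]
  constructor
  · intro h
    refine ⟨funext fun k => ?_, ?_⟩
    · have := congrFun h k.castSucc
      rwa [Fin.snoc_castSucc] at this
    · have := congrFun h (Fin.last (n + 1))
      rwa [Fin.snoc_last] at this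
  · rintro ⟨rfl, rfl⟩
    ext1 k
    refine Fin.lastCases ?_ (fun k => ?_) k
    · rw [Fin.snoc_last]
      rfl
    · rw [Fin.snoc_castSucc]
      rfl

/-- The event of a given cell path belongs to the past of `X`, so the Markov property of `X` applies
although the cell process itself need not be Markov. Each term is an integral over that event of the
kernel minus the matrix entry; summing over `i` produces `kernelDefect` at `X n`, and the path
events partition `Ω`. -/
theorem IsPartiallyObserved.sum_abs_defect_le [IsMarkovKernel K] [IsProbabilityMeasure P]
    (h : IsPartiallyObserved a b m S σ K P X y) {I : (L : ℕ+) → Fin L → Set ℝ}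
    (hI : ∀ L, IsUniformPartition a b L (I L)) (L : ℕ+)
    (hint : Integrable (kernelDefect I K (P.map (X 0)) L) (P.map (X 0))) (n : ℕ) :
    ∑ z : Fin (n + 1) → Fin M → Fin L, ∑ i,
      |P.real (initialPath (n + 2) (fun k ω => cellIndex (I L) (X k ω)) ⁻¹'
          {Fin.snoc (α := fun _ => Fin M → Fin L) z i}) -
        transitionMatrix P X (I L) i (z (Fin.last n)) *
          P.real (initialPath (n + 1) (fun k ω => cellIndex (I L) (X k ω)) ⁻¹' {z})| ≤
      ∫ x, kernelDefect I K (P.map (X 0)) L x ∂P.map (X 0) := by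
  set W : ℕ → Ω → Fin M → Fin L := fun k ω => cellIndex (I L) (X k ω) with hWdef
  have hX := h.measurable_state n
  have hW : ∀ k, Measurable (W k) := fun k =>
    (hI L).measurable_cellIndex.comp (h.measurable_state k)
  have hWn := measurable_initialPath hW (n + 1)
  have hmeas : ∀ z, MeasurableSet (initialPath (n + 1) W ⁻¹' {z}) := fun z =>
    hWn (measurableSet_singleton z)
  have hstate : ∀ z, MeasurableSet[stateSigma X n] (initialPath (n + 1) W ⁻¹' {z}) := by
    intro z
    have h1 : initialPath (n + 1) W ⁻¹' {z} =
        ⋂ k : Fin (n + 1), X k ⁻¹' (cellIndex (I L) ⁻¹' {z k}) := by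
      ext ω
      simp only [Set.mem_preimage, Set.mem_singleton_iff, Set.mem_iInter]
      exact funext_iff
    rw [h1]
    refine MeasurableSet.iInter fun k => ?_
    exact le_iSup₂ (f := fun k (_ : k ≤ n) => MeasurableSpace.comap (X k) inferInstance) (k : ℕ)
      (by omega) _ ⟨_, (hI L).measurable_cellIndex (measurableSet_singleton _), rfl⟩
  let D : (Fin M → Fin L) → Ω → ℝ := fun i ω =>
    (K (X n ω)).real (cell (I L) i) - transitionMatrix P X (I L) i (W n ω)
  have hAint : ∀ i, Integrable (fun ω => transitionMatrix P X (I L) i (W n ω)) P := fun i => by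
    refine Integrable.of_bound ((measurable_of_finite fun j =>
      transitionMatrix P X (I L) i j).comp (hW n)).aestronglyMeasurable 1
      (Eventually.of_forall fun ω => ?_)
    rw [transitionMatrix, Matrix.of_apply, Real.norm_of_nonneg measureReal_nonneg]
    exact measureReal_le_one
  have hDint : ∀ i, Integrable (D i) P := fun i =>
    (h.integrable_kernel n ((hI L).measurableSet_cell i)).sub (hAint i)
  have hdef : ∀ ω, ∑ i, |D i ω| = kernelDefect I K (P.map (X 0)) L (X n ω) := fun ω =>
    Finset.sum_congr rfl fun i _ => by
      rw [← h.transitionMatrix_eq_cumKernel (hI L)]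
  have hterm : ∀ z i, P.real (initialPath (n + 2) W ⁻¹'
        {Fin.snoc (α := fun _ => Fin M → Fin L) z i}) -
      transitionMatrix P X (I L) i (z (Fin.last n)) * P.real (initialPath (n + 1) W ⁻¹' {z}) =
      ∫ ω in initialPath (n + 1) W ⁻¹' {z}, D i ω ∂P := by
    intro z i
    rw [integral_sub (h.integrable_kernel n ((hI L).measurableSet_cell i)).integrableOn
      (hAint i).integrableOn, ← h.real_inter_preimage n (hstate z) ((hI L).measurableSet_cell i),
      initialPath_snoc]
    congr 1
    · exact measureReal_congr
        ((ae_eq_refl _).inter (h.cellIndex_ae_eq_iff (hI L) (n + 1) i).symm)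
    · have : ∫ ω in initialPath (n + 1) W ⁻¹' {z}, transitionMatrix P X (I L) i (W n ω) ∂P =
          ∫ ω in initialPath (n + 1) W ⁻¹' {z},
            transitionMatrix P X (I L) i (z (Fin.last n)) ∂P := by
        refine setIntegral_congr_fun (hmeas z) fun ω hω => ?_
        have : W n ω = z (Fin.last n) := 
          congrFun (show initialPath (n + 1) W ω = z from hω) (Fin.last n)
        simp only [this]
      rw [this]
      simp [mul_comm]
  calc _ ≤ ∑ z : Fin (n + 1) → Fin M → Fin L, ∑ i,
        ∫ ω in initialPath (n + 1) W ⁻¹' {z}, |D i ω| ∂P := by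
        refine Finset.sum_le_sum fun z _ => Finset.sum_le_sum fun i _ => ?_
        rw [hterm]
        exact abs_integral_le_integral_abs
    _ = ∑ z : Fin (n + 1) → Fin M → Fin L, ∫ ω in initialPath (n + 1) W ⁻¹' {z},
        kernelDefect I K (P.map (X 0)) L (X n ω) ∂P := by
        refine Finset.sum_congr rfl fun z _ => ?_
        rw [← integral_finsetSum _ fun i _ => (hDint i).abs.integrableOn]
        simp only [hdef]
    _ = ∫ ω, kernelDefect I K (P.map (X 0)) L (X n ω) ∂P := by
        have hi : Integrable (fun ω => kernelDefect I K (P.map (X 0)) L (X n ω)) P := by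
          rw [← h.map_state_eq n] at hint ⊢
          exact hint.comp_measurable hX
        rw [← integral_iUnion_fintype hmeas (fun z z' hne => Disjoint.preimage _ (by simpa using hne))
          fun z => hi.integrableOn]
        have : ⋃ z, initialPath (n + 1) W ⁻¹' {z} = Set.univ := by
          ext ω
          simp
        rw [this, setIntegral_univ]
    _ = _ := by
        -- By stationarity the bound is the same integral at every time `n`.
        conv_rhs => rw [← h.map_state_eq n]
        rw [integral_map hX.aemeasurable (measurable_kernelDefect hI L).aestronglyMeasurable]
        simp only [h.map_state_eq n]

end GridFilter

end PathLaws

/-! ### Total variation distance of the path laws -/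

section TotalVariation

namespace GridFilter

variable {Ω : Type*} [MeasurableSpace Ω] {M N : ℕ} {a b : ℝ}
  {m : ℕ → (Fin M → ℝ) → EuclideanSpace ℝ (Fin N)}
  {S : ℕ → (Fin M → ℝ) → Matrix (Fin N) (Fin N) ℝ} {σ : ℝ}
  {K : Kernel (Fin M → ℝ) (Fin M → ℝ)} {P Q : Measure Ω}
  {X : ℕ → Ω → Fin M → ℝ} {y : ℕ → Ω → EuclideanSpace ℝ (Fin N)} {T : ℕ}

theorem IsAuxiliaryChain.mono {L : ℕ+} {J : Fin L → Set ℝ} {Z : ℕ → Ω → Fin M → Fin L}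
    (h : IsAuxiliaryChain T X y P Q J Z) {t : ℕ} (ht : t ≤ T) :
    IsAuxiliaryChain t X y P Q J Z := by
  have hr : Measurable fun (x : Fin (T + 2) → Fin M → Fin L) (n : Fin (t + 2)) =>
      x (Fin.castLE (by omega) n) := by fun_prop
  have hr' : Measurable fun (v : Fin (T + 1) → EuclideanSpace ℝ (Fin N)) (n : Fin (t + 1)) =>
      v (Fin.castLE (by omega) n) := by fun_prop
  exact ⟨h.measurable, h.indep.comp hr hr', fun n hn => h.markov n (hn.trans ht), h.initial⟩

theorem setOf_forall_le_eq_preimage {Ω J : Type*} (Z : ℕ → Ω → J) (n : ℕ) (z : ℕ → J) :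
    {ω | ∀ k ≤ n, Z k ω = z k} = initialPath (n + 1) Z ⁻¹' {fun k : Fin (n + 1) => z k} := by
  ext ω
  simp only [Set.mem_ofPred_eq, Set.mem_preimage, Set.mem_singleton_iff]
  constructor
  · exact fun h => funext fun k => h k (by omega)
  · exact fun h k hk => congrFun h ⟨k, by omega⟩

theorem IsAuxiliaryChain.real_snoc {L : ℕ+} {J : Fin L → Set ℝ} {Z : ℕ → Ω → Fin M → Fin L}
    (h : IsAuxiliaryChain T X y P Q J Z) {n : ℕ} (hn : n ≤ T) (z : Fin (n + 1) → Fin M → Fin L)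
    (i : Fin M → Fin L) (hz : P (X 0 ⁻¹' cell J (z (Fin.last n))) ≠ 0) :
    Q.real (initialPath (n + 2) Z ⁻¹' {Fin.snoc (α := fun _ => Fin M → Fin L) z i}) =
      transitionMatrix P X J i (z (Fin.last n)) * Q.real (initialPath (n + 1) Z ⁻¹' {z}) := by
  -- The chain's Markov clause takes an infinite sequence of cells, so the finite path is continued
  -- by the constant `i`.
  let z' : ℕ → Fin M → Fin L := fun k => if hk : k < n + 1 then z ⟨k, hk⟩ else i
  have h1 : (fun k : Fin (n + 1) => z' k) = z := funext fun k => dif_pos k.2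
  have h2 : (fun k : Fin (n + 2) => z' k) = Fin.snoc (α := fun _ => Fin M → Fin L) z i := by
    ext1 k
    refine Fin.lastCases ?_ (fun k => ?_) k
    · rw [Fin.snoc_last]
      exact dif_neg (by simp)
    · rw [Fin.snoc_castSucc]
      exact dif_pos k.2
  have h3 : z' n = z (Fin.last n) := dif_pos (Nat.lt_succ_self n)
  have h4 : z' (n + 1) = i := dif_neg (by simp)
  have h5 := h.markov n hn z' (by rwa [h3])
  rwa [setOf_forall_le_eq_preimage, setOf_forall_le_eq_preimage, h1, h2, h3, h4] at h5

/-- The mean of a process with values in the standard basis has the state probabilities as its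
components. -/
theorem IsAuxiliaryChain.real_initial [IsProbabilityMeasure P] [IsProbabilityMeasure Q] {L : ℕ+}
    {J : Fin L → Set ℝ} (hJ : IsUniformPartition a b L J) (hX : Measurable (X 0))
    {Z : ℕ → Ω → Fin M → Fin L} (h : IsAuxiliaryChain T X y P Q J Z) (j : Fin M → Fin L) :
    Q.real (Z 0 ⁻¹' {j}) = P.real (X 0 ⁻¹' cell J j) := by
  have e1 : ∀ i : Fin M → Fin L, (fun ω => basisProcess Z 0 ω i) =
      (Z 0 ⁻¹' {i}).indicator fun _ => (1 : ℝ) := by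
    intro i
    ext ω
    by_cases hi : Z 0 ω = i
    · rw [Set.indicator_of_mem (show ω ∈ Z 0 ⁻¹' {i} from hi), basisProcess, hi, Pi.single_eq_same]
    · rw [Set.indicator_of_notMem (show ω ∉ Z 0 ⁻¹' {i} from hi), basisProcess,
        Pi.single_eq_of_ne (Ne.symm hi)]
  have e2 : ∀ i : Fin M → Fin L, (fun ω => basisQuantizer J (X 0 ω) i) =
      (X 0 ⁻¹' cell J i).indicator fun _ => (1 : ℝ) := fun i => rfl
  have m1 : ∀ i, MeasurableSet (Z 0 ⁻¹' {i}) := fun i => h.measurable 0 (measurableSet_singleton i)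
  have m2 : ∀ i, MeasurableSet (X 0 ⁻¹' cell J i) := fun i => hX (hJ.measurableSet_cell i)
  have h0 := congrFun h.initial j
  rw [eval_integral (f := fun ω => basisProcess Z 0 ω) (fun i => by rw [e1]; exact (integrable_const _).indicator (m1 i)),
    eval_integral (f := fun ω => basisQuantizer J (X 0 ω)) (fun i => by rw [e2]; exact (integrable_const _).indicator (m2 i)),
    e1, e2, integral_indicator (m1 j), integral_indicator (m2 j)] at h0
  simpa using h0

/-- The Markov clause is silent about leaving null cells, so it must be shown that the chain never
reaches one. Either the preceding cell is already null, or the transition probability vanishes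
because by stationarity `X 1` also avoids the cell. -/
theorem IsAuxiliaryChain.real_eq_zero [IsMarkovKernel K] [IsProbabilityMeasure P]
    [IsProbabilityMeasure Q] (hsys : IsPartiallyObserved a b m S σ K P X y) {L : ℕ+}
    {J : Fin L → Set ℝ} (hJ : IsUniformPartition a b L J)
    {Z : ℕ → Ω → Fin M → Fin L} (h : IsAuxiliaryChain T X y P Q J Z) {n : ℕ} (hn : n ≤ T + 1)
    (z : Fin (n + 1) → Fin M → Fin L) (hz : P (X 0 ⁻¹' cell J (z (Fin.last n))) = 0) :
    Q.real (initialPath (n + 1) Z ⁻¹' {z}) = 0 := by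
  induction n with
  | zero =>
    have : initialPath (0 + 1) Z ⁻¹' {z} ⊆ Z 0 ⁻¹' {z (Fin.last 0)} := fun ω hω =>
      congrFun (show initialPath 1 Z ω = z from hω) 0
    refine le_antisymm ((measureReal_mono this).trans ?_) measureReal_nonneg
    rw [h.real_initial hJ (hsys.measurable_state 0), measureReal_def, hz]
    simp
  | succ n ih =>
    have hzs : z = Fin.snoc (α := fun _ => Fin M → Fin L) (Fin.init z) (z (Fin.last (n + 1))) :=
      (Fin.snoc_init_self z).symm
    rw [hzs]
    by_cases h0 : P (X 0 ⁻¹' cell J (Fin.init z (Fin.last n))) = 0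
    · rw [initialPath_snoc]
      exact le_antisymm ((measureReal_mono Set.inter_subset_left).trans
        (ih (by omega) _ h0).le) measureReal_nonneg
    · rw [h.real_snoc (by omega) _ _ h0, transitionMatrix, Matrix.of_apply]
      have h1 : P (X 1 ⁻¹' cell J (z (Fin.last (n + 1)))) = 0 := by
        rw [← Measure.map_apply (hsys.measurable_state 1) (hJ.measurableSet_cell _),
          hsys.map_state_eq 1, Measure.map_apply (hsys.measurable_state 0)
            (hJ.measurableSet_cell _), hz]
      rw [measureReal_def, cond_absolutelyContinuous h1]
      simp

/-- The path laws of the marginal quantization and of the auxiliary chain are close in total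
variation. -/
theorem IsAuxiliaryChain.sum_abs_sub_le [IsMarkovKernel K] [IsProbabilityMeasure P]
    [IsProbabilityMeasure Q] (hsys : IsPartiallyObserved a b m S σ K P X y)
    {I : (L : ℕ+) → Fin L → Set ℝ} (hI : ∀ L, IsUniformPartition a b L (I L)) {L : ℕ+}
    (hint : Integrable (kernelDefect I K (P.map (X 0)) L) (P.map (X 0)))
    {Z : ℕ → Ω → Fin M → Fin L} (h : IsAuxiliaryChain T X y P Q (I L) Z) :
    ∑ z : Fin (T + 2) → Fin M → Fin L,
      |P.real (initialPath (T + 2) (fun k ω => cellIndex (I L) (X k ω)) ⁻¹' {z}) -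
        Q.real (initialPath (T + 2) Z ⁻¹' {z})| ≤
      ((T + 1 : ℕ) : ℝ) * ∫ x, kernelDefect I K (P.map (X 0)) L x ∂P.map (X 0) := by
  refine sum_abs_sub_le_of_transition
    (p := fun n z => P.real (initialPath (n + 1) (fun k ω => cellIndex (I L) (X k ω)) ⁻¹' {z}))
    (q := fun n z => Q.real (initialPath (n + 1) Z ⁻¹' {z}))
    (A := transitionMatrix P X (I L)) (T := T) (fun z => ?_) (fun i j => measureReal_nonneg)
    (fun j => (hI L).sum_transitionMatrix_le (hsys.measurable_state 1) j) (fun n hn z i => ?_)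
    (fun n => hsys.sum_abs_defect_le hI L hint n) (T + 1) le_rfl
  · have e : ∀ W : ℕ → Ω → Fin M → Fin L, initialPath (0 + 1) W ⁻¹' {z} = W 0 ⁻¹' {z 0} := by
      intro W
      ext ω
      simp only [Set.mem_preimage, Set.mem_singleton_iff]
      refine ⟨fun h => congrFun h 0, fun h => funext fun k => ?_⟩
      rw [show k = 0 from Fin.fin_one_eq_zero k]
      exact h
    simp only [e]
    rw [h.real_initial (hI L) (hsys.measurable_state 0)]
    exact measureReal_congr (hsys.cellIndex_ae_eq_iff (hI L) 0 _).symm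
  -- If the path ends in a null cell, the required identity reads 0 = 0.
  · by_cases hz : P (X 0 ⁻¹' cell (I L) (z (Fin.last n))) = 0
    · have h0 := h.real_eq_zero hsys (hI L) (by omega) z hz
      simp only [h0, mul_zero]
      rw [initialPath_snoc]
      exact le_antisymm ((measureReal_mono Set.inter_subset_left).trans h0.le) measureReal_nonneg
    · exact h.real_snoc hn z i hz

end GridFilter

end TotalVariation

/-! ### Uniform convergence of posterior means -/

section UniformConvergence

namespace GridFilter

variable {Ω : Type*} [MeasurableSpace Ω] {M N : ℕ} {a b : ℝ}
  {m : ℕ → (Fin M → ℝ) → EuclideanSpace ℝ (Fin N)}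
  {S : ℕ → (Fin M → ℝ) → Matrix (Fin N) (Fin N) ℝ} {σ : ℝ}
  {K : Kernel (Fin M → ℝ) (Fin M → ℝ)} {P Q : Measure Ω}
  {X : ℕ → Ω → Fin M → ℝ} {y : ℕ → Ω → EuclideanSpace ℝ (Fin N)} {t : ℕ}
  {F : Type*} [NormedAddCommGroup F] [NormedSpace ℝ F]

/-- Paths of `n` states in `[a,b]^M`. -/
def pathBox (M : ℕ) (a b : ℝ) (n : ℕ) : Set (Fin n → Fin M → ℝ) :=
  Set.univ.pi fun _ => box M a b

theorem isCompact_pathBox (M : ℕ) (a b : ℝ) (n : ℕ) : IsCompact (pathBox M a b n) :=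
  isCompact_univ_pi fun _ => isCompact_Icc

/-- Both integrals live on the same `Ω`, where the arguments are within `d L`; uniform continuity on
`A ×ˢ V` then makes the bound independent of `v`. -/
theorem eventually_norm_integral_sub_le {α β : Type*} [PseudoMetricSpace α]
    [SecondCountableTopology α] [MeasurableSpace α] [OpensMeasurableSpace α] [PseudoMetricSpace β]
    {A : Set α} (hA : IsCompact A) {V : Set β} (hV : IsCompact V)
    {G : α × β → F} (hG : Continuous G)
    [IsProbabilityMeasure Q] {η : Ω → α} (hη : Measurable η)
    {ξ : ℕ+ → Ω → α} (hξ : ∀ L, Measurable (ξ L))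
    (hηb : ∀ᵐ ω ∂Q, η ω ∈ A) (hξb : ∀ L, ∀ᵐ ω ∂Q, ξ L ω ∈ A)
    {d : ℕ+ → ℝ} (hd : Tendsto d atTop (𝓝 0)) (hdist : ∀ L, ∀ᵐ ω ∂Q, dist (ξ L ω) (η ω) ≤ d L)
    {ε : ℝ} (hε : 0 < ε) :
    ∀ᶠ L in atTop, ∀ v ∈ V,
      ‖∫ x, G (x, v) ∂Q.map (ξ L) - ∫ x, G (x, v) ∂Q.map η‖ ≤ ε := by
  have hcomp : IsCompact (A ×ˢ V) := hA.prod hV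
  obtain ⟨δ, hδ, hun⟩ := Metric.uniformContinuousOn_iff.1
    (hcomp.uniformContinuousOn_of_continuous hG.continuousOn) ε hε
  obtain ⟨B, hB⟩ := hcomp.exists_bound_of_continuousOn hG.continuousOn
  have hGv : ∀ v, Continuous fun x => G (x, v) := fun v => by fun_prop
  have hint : ∀ v ∈ V, ∀ ζ : Ω → α, Measurable ζ → (∀ᵐ ω ∂Q, ζ ω ∈ A) →
      Integrable (fun ω => G (ζ ω, v)) Q := by
    intro v hv ζ hζ hζb
    refine Integrable.of_bound ((hGv v).comp_aestronglyMeasurable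
      hζ.aestronglyMeasurable) B ?_
    filter_upwards [hζb] with ω hω using hB _ ⟨hω, hv⟩
  filter_upwards [hd.eventually_lt_const hδ] with L hL v hv
  rw [integral_map (hξ L).aemeasurable (hGv v).aestronglyMeasurable,
    integral_map hη.aemeasurable (hGv v).aestronglyMeasurable,
    ← integral_sub (hint v hv _ (hξ L) (hξb L)) (hint v hv _ hη hηb)]
  have h1 := norm_integral_le_of_norm_le_const (μ := Q) (C := ε)
    (f := fun ω => G (ξ L ω, v) - G (η ω, v)) (by
      filter_upwards [hηb, hξb L, hdist L] with ω h1 h2 h3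
      rw [← dist_eq_norm]
      refine (hun _ ⟨h2, hv⟩ _ ⟨h1, hv⟩ ?_).le
      rw [Prod.dist_eq, dist_self, max_eq_left dist_nonneg]
      exact h3.trans_lt hL)
  simpa using h1

/-- Both integrals are finite sums over the same points, so only the weights differ; `c` need not be
injective. -/
theorem norm_integral_map_sub_le [CompleteSpace F] [IsFiniteMeasure Q] {α J : Type*} [Fintype J]
    [MeasurableSpace J] [MeasurableSingletonClass J] [MeasurableSpace α] {g : α → F}
    (hg : StronglyMeasurable g) {c : J → α} (hc : Measurable c) {W Z : Ω → J} (hW : Measurable W)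
    (hZ : Measurable Z) {B : ℝ} (hB : ∀ z, ‖g (c z)‖ ≤ B) :
    ‖∫ x, g x ∂Q.map (fun ω => c (W ω)) - ∫ x, g x ∂Q.map (fun ω => c (Z ω))‖ ≤
      (∑ z, |Q.real (W ⁻¹' {z}) - Q.real (Z ⁻¹' {z})|) * B := by
  have h1 : ∀ {V : Ω → J}, Measurable V → ∫ x, g x ∂Q.map (fun ω => c (V ω)) =
      ∑ z, Q.real (V ⁻¹' {z}) • g (c z) := by
    intro V hV
    have e : Q.map (fun ω => c (V ω)) = (Q.map V).map c := (Measure.map_map hc hV).symm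
    rw [e, integral_map hc.aemeasurable hg.aestronglyMeasurable, integral_fintype .of_finite]
    simp only [map_measureReal_apply hV (measurableSet_singleton _)]
  rw [h1 hW, h1 hZ, ← Finset.sum_sub_distrib, Finset.sum_mul]
  refine norm_sum_le_of_le _ fun z _ => ?_
  rw [← sub_smul, norm_smul, Real.norm_eq_abs]
  exact mul_le_mul_of_nonneg_left (hB z) (abs_nonneg _)

theorem eventually_norm_integral_map_sub_le [CompleteSpace F] [IsFiniteMeasure Q] {α β : Type*}
    [PseudoMetricSpace α] [SecondCountableTopology α] [MeasurableSpace α] [OpensMeasurableSpace α]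
    [PseudoMetricSpace β] {A : Set α} (hA : IsCompact A) {V : Set β} (hV : IsCompact V)
    {G : α × β → F} (hG : Continuous G) {J : ℕ+ → Type*} [∀ L, Fintype (J L)]
    [∀ L, MeasurableSpace (J L)] [∀ L, MeasurableSingletonClass (J L)]
    {c : (L : ℕ+) → J L → α} (hc : ∀ L z, c L z ∈ A) {W Z : (L : ℕ+) → Ω → J L}
    (hW : ∀ L, Measurable (W L)) (hZ : ∀ L, Measurable (Z L)) {d : ℕ+ → ℝ}
    (hd : Tendsto d atTop (𝓝 0))
    (htv : ∀ L, ∑ z, |Q.real (W L ⁻¹' {z}) - Q.real (Z L ⁻¹' {z})| ≤ d L)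
    {ε : ℝ} (hε : 0 < ε) :
    ∀ᶠ L in atTop, ∀ v ∈ V, ‖∫ x, G (x, v) ∂Q.map (fun ω => c L (W L ω)) -
      ∫ x, G (x, v) ∂Q.map (fun ω => c L (Z L ω))‖ ≤ ε := by
  obtain ⟨B, hB⟩ := (hA.prod hV).exists_bound_of_continuousOn hG.continuousOn
  -- Compactness gives a bound whose sign is not known; `max B 0` allows multiplication of
  -- inequalities.
  have hlim := hd.mul_const (max B 0)
  rw [zero_mul] at hlim
  filter_upwards [hlim.eventually_lt_const hε] with L hL v hv
  have hGv : Continuous fun x => G (x, v) := by fun_prop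
  refine (norm_integral_map_sub_le hGv.stronglyMeasurable (measurable_of_finite (c L)) (hW L)
    (hZ L) (B := max B 0) fun z => (hB _ ⟨hc L z, hv⟩).trans (le_max_left _ _)).trans ?_
  exact (mul_le_mul_of_nonneg_right (htv L) (le_max_right _ _)).trans hL.le

/-- With q' the second quotient, the difference is d⁻¹((n - n') + (d' - d) q'), so only a lower
bound on the denominators and a bound on q' are needed. -/
theorem norm_inv_smul_sub_inv_smul_le {d d' c B ε : ℝ} {n n' : F} (hc : 0 < c) (hd : c ≤ d)
    (hd' : c ≤ d') (hB : ‖d'⁻¹ • n'‖ ≤ B) (h1 : |d - d'| ≤ ε) (h2 : ‖n - n'‖ ≤ ε) :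
    ‖d⁻¹ • n - d'⁻¹ • n'‖ ≤ c⁻¹ * (ε + ε * B) := by
  have hd0 : 0 < d := hc.trans_le hd
  have hd0' : 0 < d' := hc.trans_le hd'
  have hε : 0 ≤ ε := (abs_nonneg _).trans h1
  have e : d⁻¹ • n - d'⁻¹ • n' = d⁻¹ • ((n - n') + (d' - d) • (d'⁻¹ • n')) := by
    rw [sub_smul, smul_inv_smul₀ hd0'.ne', smul_add, smul_sub, smul_sub, inv_smul_smul₀ hd0.ne']
    abel
  rw [e, norm_smul, norm_inv, Real.norm_of_nonneg hd0.le]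
  refine mul_le_mul (inv_anti₀ hc hd) ((norm_add_le _ _).trans (add_le_add h2 ?_))
    (norm_nonneg _) (inv_nonneg.2 hc.le)
  rw [norm_smul, Real.norm_eq_abs, abs_sub_comm]
  exact mul_le_mul h1 hB (norm_nonneg _) hε

/-- The denominators are at least the positive lower bound of the likelihood on the compact set of
paths and observations, and posterior means are bounded by max(|a|, |b|). -/
theorem eventually_norm_pathPosterior_sub_le (hobs : ObsAssumptions a b m S σ) (hab : a ≤ b)
    {R : ℝ} {ρ ρ' : ℕ+ → Measure (Fin (t + 2) → Fin M → ℝ)} [∀ L, IsProbabilityMeasure (ρ L)]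
    [∀ L, IsProbabilityMeasure (ρ' L)] (hρ : ∀ L, ∀ᵐ x ∂ρ L, x ∈ pathBox M a b (t + 2))
    (hρ' : ∀ L, ∀ᵐ x ∂ρ' L, x ∈ pathBox M a b (t + 2))
    (hden : ∀ ε : ℝ, 0 < ε → ∀ᶠ L in atTop, ∀ v ∈ Metric.closedBall 0 R,
      ‖∫ x, pathLikelihood a b m S σ t (x, v) ∂ρ L -
        ∫ x, pathLikelihood a b m S σ t (x, v) ∂ρ' L‖ ≤ ε)
    (hnum : ∀ ε : ℝ, 0 < ε → ∀ᶠ L in atTop, ∀ v ∈ Metric.closedBall 0 R,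
      ‖∫ x, pathLikelihood a b m S σ t (x, v) • x (Fin.last (t + 1)) ∂ρ L -
        ∫ x, pathLikelihood a b m S σ t (x, v) • x (Fin.last (t + 1)) ∂ρ' L‖ ≤ ε)
    {ε : ℝ} (hε : 0 < ε) :
    ∀ᶠ L in atTop, ∀ v ∈ Metric.closedBall 0 R,
      ‖pathPosterior a b m S σ t (ρ L) v - pathPosterior a b m S σ t (ρ' L) v‖ ≤ ε := by
  have hΛc := hobs.continuous_pathLikelihood hab t
  obtain ⟨B₀, hB₀, hB⟩ := hobs.exists_pathLikelihood_le hab t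
  have hcomp : IsCompact (pathBox M a b (t + 2) ×ˢ
      Metric.closedBall (0 : Fin (t + 1) → EuclideanSpace ℝ (Fin N)) R) :=
    (isCompact_pathBox M a b _).prod (isCompact_closedBall _ _)
  obtain ⟨c, hc, hcle⟩ := hcomp.exists_forall_le' hΛc.continuousOn
    fun p _ => hobs.pathLikelihood_pos hab t p
  have hΛi : ∀ (μ : Measure (Fin (t + 2) → Fin M → ℝ)) [IsProbabilityMeasure μ] v,
      Integrable (fun x => pathLikelihood a b m S σ t (x, v)) μ := fun μ _ v => by
    refine Integrable.of_bound (by fun_prop) B₀ (Eventually.of_forall fun x => ?_)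
    rw [Real.norm_of_nonneg (hobs.pathLikelihood_pos hab t _).le]
    exact hB _
  have hlow : ∀ (μ : Measure (Fin (t + 2) → Fin M → ℝ)) [IsProbabilityMeasure μ],
      (∀ᵐ x ∂μ, x ∈ pathBox M a b (t + 2)) → ∀ v ∈ Metric.closedBall 0 R,
      c ≤ ∫ x, pathLikelihood a b m S σ t (x, v) ∂μ := by
    intro μ _ hμ v hv
    have h1 : ∫ _x, c ∂μ ≤ ∫ x, pathLikelihood a b m S σ t (x, v) ∂μ := by
      refine integral_mono_ae (integrable_const c) (hΛi μ v) ?_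
      filter_upwards [hμ] with x hx using hcle _ ⟨hx, hv⟩
    simpa using h1
  set B := max |a| |b|
  have hB1 : 0 ≤ B := by positivity
  -- Chosen so that c⁻¹(ε' + ε' B) = ε.
  set ε' := ε * c / (1 + B)
  have hε' : 0 < ε' := by positivity
  filter_upwards [hden ε' hε', hnum ε' hε'] with L h1 h2 v hv
  have hle : c⁻¹ * (ε' + ε' * B) = ε := by
    simp only [ε']
    field_simp
  rw [← hle]
  refine norm_inv_smul_sub_inv_smul_le hc (hlow _ (hρ L) v hv) (hlow _ (hρ' L) v hv) ?_
    (h1 v hv) (h2 v hv)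
  refine norm_posterior_le (fun p => (hobs.pathLikelihood_pos hab t p).le) (hΛi _ v) hB1 ?_
  filter_upwards [hρ' L] with x hx
  exact norm_le_of_mem_box (hx _ trivial)

theorem IsReferenceMeasure.map_state_initialPath (h : IsReferenceMeasure t X y P Q) :
    Q.map (initialPath (t + 2) X) = P.map (initialPath (t + 2) X) := h.map_state

theorem measurableSet_pathBox (n : ℕ) : MeasurableSet (pathBox M a b n) :=
  MeasurableSet.univ_pi fun _ => measurableSet_Icc

theorem IsPartiallyObserved.ae_mem_pathBox (h : IsPartiallyObserved a b m S σ K P X y)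
    (hQ : IsReferenceMeasure t X y P Q) : ∀ᵐ ω ∂Q, initialPath (t + 2) X ω ∈ pathBox M a b _ := by
  have hU := measurable_initialPath h.measurable_state (t + 2)
  have h1 : ∀ᵐ x ∂P.map (initialPath (t + 2) X), x ∈ pathBox M a b (t + 2) := by
    refine (mem_ae_map_iff hU.aemeasurable (measurableSet_pathBox _)).2 ?_
    filter_upwards [ae_all_iff.2 h.state_mem] with ω hω k _ using hω k
  rw [← hQ.map_state_initialPath] at h1
  exact ae_of_ae_map hU.aemeasurable h1

theorem tendsto_meshsize (a b : ℝ) : Tendsto (fun L : ℕ+ => (b - a) / (L : ℝ)) atTop (𝓝 0) := by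
  have h1 : Tendsto (fun L : ℕ+ => ((L : ℕ) : ℝ)) atTop atTop :=
    tendsto_natCast_atTop_atTop.comp tendsto_PNat_val_atTop_atTop
  exact h1.const_div_atTop _

variable {I : (L : ℕ+) → Fin L → Set ℝ}

theorem measurable_marginalQuantization (hI : ∀ L, IsUniformPartition a b L (I L))
    (hX : ∀ n, Measurable (X n)) (L : ℕ+) (n : ℕ) :
    Measurable (marginalQuantization a b (I L) X n) :=
  (hI L).measurable_quantizer.comp (hX n)

theorem marginalQuantization_eq {Ω : Type*} {X : ℕ → Ω → Fin M → ℝ}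
    (hI : ∀ L, IsUniformPartition a b L (I L)) {n : ℕ} {ω : Ω}
    (hω : X n ω ∈ box M a b) (L : ℕ+) : marginalQuantization a b (I L) X n ω =
      fun i => recon M a b L i (cellIndex (I L) (X n ω)) := (hI L).quantizer_eq hω

theorem IsPartiallyObserved.ae_mem_pathBox_quantization (hab : a ≤ b)
    (hI : ∀ L, IsUniformPartition a b L (I L)) (h : IsPartiallyObserved a b m S σ K P X y)
    (hQ : IsReferenceMeasure t X y P Q) (L : ℕ+) :
    ∀ᵐ ω ∂Q, initialPath (t + 2) (marginalQuantization a b (I L) X) ω ∈ pathBox M a b _ := by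
  filter_upwards [h.ae_mem_pathBox hQ] with ω hω k _
  rw [initialPath, marginalQuantization_eq hI (hω k trivial)]
  exact recon_mem_box hab L _

theorem ae_map_mem_pathBox {n : ℕ} {ξ : Ω → Fin n → Fin M → ℝ} (hξ : Measurable ξ)
    (h : ∀ᵐ ω ∂Q, ξ ω ∈ pathBox M a b n) : ∀ᵐ x ∂Q.map ξ, x ∈ pathBox M a b n :=
  (mem_ae_map_iff hξ.aemeasurable (measurableSet_pathBox _)).2 h

/-- The filter of the marginal quantization converges to the MMSE filter, uniformly over bounded
observations. -/
theorem IsPartiallyObserved.eventually_norm_quantization_sub_le [IsProbabilityMeasure P]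
    [IsProbabilityMeasure Q] (hobs : ObsAssumptions a b m S σ) (hab : a ≤ b)
    (hI : ∀ L, IsUniformPartition a b L (I L)) (h : IsPartiallyObserved a b m S σ K P X y)
    (hQ : IsReferenceMeasure t X y P Q) (R : ℝ) {ε : ℝ} (hε : 0 < ε) :
    ∀ᶠ L in atTop, ∀ v ∈ Metric.closedBall 0 R,
      ‖pathPosterior a b m S σ t
          (Q.map (initialPath (t + 2) (marginalQuantization a b (I L) X))) v -
        pathPosterior a b m S σ t (P.map (initialPath (t + 2) X)) v‖ ≤ ε := by
  have hη := measurable_initialPath h.measurable_state (t + 2)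
  have hξ := fun L => measurable_initialPath
    (measurable_marginalQuantization hI h.measurable_state L) (t + 2)
  have hηb := h.ae_mem_pathBox hQ
  have hξb := h.ae_mem_pathBox_quantization hab hI hQ
  -- In the sup metric a path moves no more than its worst single state, so the path length does not
  -- enter.
  have hdist : ∀ L, ∀ᵐ ω ∂Q, dist (initialPath (t + 2) (marginalQuantization a b (I L) X) ω)
      (initialPath (t + 2) X ω) ≤ (b - a) / L := by
    intro L
    filter_upwards [hηb] with ω hω
    refine (dist_pi_le_iff (div_nonneg (sub_nonneg.2 hab) (Nat.cast_nonneg _))).2 fun k => ?_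
    rw [dist_eq_norm]
    exact (hI L).norm_sub_quantizer_le hab (hω k trivial)
  have hΛc := hobs.continuous_pathLikelihood hab t
  have hGc : Continuous fun p : (Fin (t + 2) → Fin M → ℝ) ×
      (Fin (t + 1) → EuclideanSpace ℝ (Fin N)) =>
      pathLikelihood a b m S σ t p • p.1 (Fin.last (t + 1)) := hΛc.smul (by fun_prop)
  have hA := isCompact_pathBox M a b (t + 2)
  have hV := isCompact_closedBall (0 : Fin (t + 1) → EuclideanSpace ℝ (Fin N)) R
  rw [← hQ.map_state_initialPath]
  have := fun L => Measure.isProbabilityMeasure_map (μ := Q) (hξ L).aemeasurable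
  have := Measure.isProbabilityMeasure_map (μ := Q) hη.aemeasurable
  exact eventually_norm_pathPosterior_sub_le hobs hab
    (ρ' := fun _ => Q.map (initialPath (t + 2) X))
    (fun L => ae_map_mem_pathBox (hξ L) (hξb L)) (fun _ => ae_map_mem_pathBox hη hηb)
    (fun ε hε => eventually_norm_integral_sub_le hA hV hΛc hη hξ hηb hξb
      (tendsto_meshsize a b) hdist hε)
    (fun ε hε => eventually_norm_integral_sub_le hA hV hGc hη hξ hηb hξb
      (tendsto_meshsize a b) hdist hε) hε

/-- The filters of the marginal quantization and of the auxiliary chain merge, uniformly over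
bounded observations. -/
theorem IsPartiallyObserved.eventually_norm_chain_sub_le [IsMarkovKernel K]
    [IsProbabilityMeasure P] [IsProbabilityMeasure Q] (hobs : ObsAssumptions a b m S σ)
    (hab : a ≤ b) (hI : ∀ L, IsUniformPartition a b L (I L))
    (h : IsPartiallyObserved a b m S σ K P X y)
    (hreg : ConditionallyRegular I K (P.map (X 0)))
    (hQ : IsReferenceMeasure t X y P Q) {Z : (L : ℕ+) → ℕ → Ω → Fin M → Fin L}
    (hZ : ∀ L, IsAuxiliaryChain t X y P Q (I L) (Z L)) (R : ℝ) {ε : ℝ} (hε : 0 < ε) :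
    ∀ᶠ L in atTop, ∀ v ∈ Metric.closedBall 0 R,
      ‖pathPosterior a b m S σ t
          (Q.map (initialPath (t + 2) (marginalQuantization a b (I L) X))) v -
        pathPosterior a b m S σ t
          (Q.map (initialPath (t + 2) fun n ω i => recon M a b L i (Z L n ω))) v‖ ≤ ε := by
  -- For M = 0 all filters take values in a one-point space; otherwise L^M tends to infinity.
  rcases eq_or_ne M 0 with rfl | hM
  · refine Eventually.of_forall fun L v _ => ?_
    rw [Subsingleton.elim (pathPosterior a b m S σ t _ v - _) 0, norm_zero]
    exact hε.le
  have hX0 := h.measurable_state 0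
  have := Measure.isProbabilityMeasure_map (μ := P) hX0.aemeasurable
  obtain ⟨hint, hlim⟩ := hreg.tendsto_integral_kernelDefect hM hab hI
    ((mem_ae_map_iff hX0.aemeasurable measurableSet_Icc).2 (h.state_mem 0))
  let W : (L : ℕ+) → ℕ → Ω → Fin M → Fin L := fun L k ω => cellIndex (I L) (X k ω)
  let c : (L : ℕ+) → (Fin (t + 2) → Fin M → Fin L) → Fin (t + 2) → Fin M → ℝ :=
    fun L z k i => recon M a b L i (z k)
  have hcbox : ∀ L z, c L z ∈ pathBox M a b (t + 2) := fun L z k _ => recon_mem_box hab L _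
  have hc : ∀ L, Measurable (c L) := fun L => measurable_of_finite _
  have hW : ∀ L, Measurable (initialPath (t + 2) (W L)) := fun L =>
    measurable_initialPath (fun k => (hI L).measurable_cellIndex.comp (h.measurable_state k)) _
  have hZm : ∀ L, Measurable (initialPath (t + 2) (Z L)) := fun L =>
    measurable_initialPath (hZ L).measurable _
  -- Both path laws are images under the same map `c L`, from cell indices to centres, so they can
  -- be compared on a finite set.
  have hρ : ∀ L, Q.map (initialPath (t + 2) (marginalQuantization a b (I L) X)) =
      Q.map fun ω => c L (initialPath (t + 2) (W L) ω) := fun L => by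
    refine Measure.map_congr ?_
    filter_upwards [h.ae_mem_pathBox hQ] with ω hω
    ext1 k
    exact marginalQuantization_eq hI (hω k trivial) L
  have hρ' : ∀ L, Q.map (initialPath (t + 2) fun n ω i => recon M a b L i (Z L n ω)) =
      Q.map fun ω => c L (initialPath (t + 2) (Z L) ω) := fun L => rfl
  simp only [hρ, hρ']
  -- The total variation bound uses the state under `P`; it holds under `Q` since the state paths
  -- have the same law.
  have htv : ∀ L, ∑ z, |Q.real (initialPath (t + 2) (W L) ⁻¹' {z}) -
      Q.real (initialPath (t + 2) (Z L) ⁻¹' {z})| ≤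
      ((t + 1 : ℕ) : ℝ) * ∫ x, kernelDefect I K (P.map (X 0)) L x ∂P.map (X 0) := by
    intro L
    refine le_trans (le_of_eq ?_) ((hZ L).sum_abs_sub_le h hI (hint L))
    refine Finset.sum_congr rfl fun z _ => ?_
    congr 2
    let r : (Fin (t + 2) → Fin M → ℝ) → Fin (t + 2) → Fin M → Fin L :=
      fun x k => cellIndex (I L) (x k)
    have hr : Measurable r := measurable_pi_lambda _ fun k =>
      (hI L).measurable_cellIndex.comp (measurable_pi_apply k)
    have hU := measurable_initialPath h.measurable_state (t + 2)
    have e := congrArg (fun μ : Measure _ => μ.real (r ⁻¹' {z})) hQ.map_state_initialPath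
    simp only [map_measureReal_apply hU (hr (measurableSet_singleton z))] at e
    exact e
  have hlim' := hlim.const_mul ((t + 1 : ℕ) : ℝ)
  rw [mul_zero] at hlim'
  have hΛc := hobs.continuous_pathLikelihood hab t
  have hGc : Continuous fun p : (Fin (t + 2) → Fin M → ℝ) ×
      (Fin (t + 1) → EuclideanSpace ℝ (Fin N)) =>
      pathLikelihood a b m S σ t p • p.1 (Fin.last (t + 1)) := hΛc.smul (by fun_prop)
  have hA := isCompact_pathBox M a b (t + 2)
  have hV := isCompact_closedBall (0 : Fin (t + 1) → EuclideanSpace ℝ (Fin N)) R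
  have : ∀ L, IsProbabilityMeasure (Q.map fun ω => c L (initialPath (t + 2) (W L) ω)) := fun L =>
    Measure.isProbabilityMeasure_map ((hc L).comp (hW L)).aemeasurable
  have : ∀ L, IsProbabilityMeasure (Q.map fun ω => c L (initialPath (t + 2) (Z L) ω)) := fun L =>
    Measure.isProbabilityMeasure_map ((hc L).comp (hZm L)).aemeasurable
  exact eventually_norm_pathPosterior_sub_le hobs hab
    (ρ := fun L => Q.map fun ω => c L (initialPath (t + 2) (W L) ω))
    (ρ' := fun L => Q.map fun ω => c L (initialPath (t + 2) (Z L) ω))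
    (fun L => ae_map_mem_pathBox ((hc L).comp (hW L)) (Eventually.of_forall fun ω => hcbox L _))
    (fun L => ae_map_mem_pathBox ((hc L).comp (hZm L)) (Eventually.of_forall fun ω => hcbox L _))
    (fun ε hε => eventually_norm_integral_map_sub_le hA hV hΛc hcbox hW hZm hlim' htv hε)
    (fun ε hε => eventually_norm_integral_map_sub_le hA hV hGc hcbox hW hZm hlim' htv hε) hε

end GridFilter

end UniformConvergence

/-! ### Convergence of the filters -/

section Convergence

namespace GridFilter

variable {Ω : Type*} {M N : ℕ} {a b : ℝ}

/-- Only finitely many times occur, so thresholds depending on `t` suffice. -/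
theorem tendsto_uniformDist {T : ℕ} {E : Set Ω} {f g : ℕ+ → ℕ → Ω → Fin M → ℝ}
    (h : ∀ t ≤ T, ∀ ε : ℝ, 0 < ε → ∀ᶠ L in atTop, ∀ ω ∈ E, ‖f L t ω - g L t ω‖ ≤ ε) :
    Tendsto (fun L => uniformDist T E (f L) (g L)) atTop (𝓝 0) := by
  rw [ENNReal.tendsto_nhds_zero]
  intro ε hε
  obtain ⟨r, hr0, hr⟩ := ENNReal.lt_iff_exists_nnreal_btwn.1 hε
  have hr0' : (0 : ℝ) < r := by exact_mod_cast hr0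
  have hM : (0 : ℝ) < (M : ℝ) + 1 := by positivity
  have h1 : ∀ᶠ L in atTop, ∀ t ∈ Finset.range (T + 1), ∀ ω ∈ E,
      -- The ℓ₁-norm is at most M times the sup norm; M + 1 keeps the divisor positive when M = 0.
      ‖f L t ω - g L t ω‖ ≤ r / ((M : ℝ) + 1) := by
    rw [Filter.eventually_all_finset]
    exact fun t ht => h t (by simpa [Nat.lt_succ_iff] using ht) _ (div_pos hr0' hM)
  filter_upwards [h1] with L hL
  refine (iSup₂_le fun t ht => iSup₂_le fun ω hω => ?_).trans hr.le
  rw [← ENNReal.ofReal_coe_nnreal]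
  refine ENNReal.ofReal_le_ofReal ((l1_le_card_mul_norm _).trans ?_)
  rw [Fintype.card_fin]
  calc (M : ℝ) * ‖f L t ω - g L t ω‖ ≤ ((M : ℝ) + 1) * (r / ((M : ℝ) + 1)) :=
        mul_le_mul (by linarith) (hL t (by simpa [Nat.lt_succ_iff] using ht) ω hω)
          (norm_nonneg _) hM.le
    _ = r := mul_div_cancel₀ _ hM.ne'

variable [MeasurableSpace Ω]

/-- Continuity from below: finitely many observations are bounded at each `ω`, so these events
exhaust `Ω`. -/
theorem exists_lt_measureReal_forall_norm_le {P : Measure Ω} [IsProbabilityMeasure P]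
    {y : ℕ → Ω → EuclideanSpace ℝ (Fin N)} (hy : ∀ t, Measurable (y t)) (T : ℕ) {ε : ℝ}
    (hε : 0 < ε) : ∃ R : ℝ, MeasurableSet {ω | ∀ t ≤ T, ‖y t ω‖ ≤ R} ∧
      1 - ε < P.real {ω | ∀ t ≤ T, ‖y t ω‖ ≤ R} := by
  have hmeas : ∀ n : ℕ, MeasurableSet {ω | ∀ t ≤ T, ‖y t ω‖ ≤ (n : ℝ)} := by
    intro n
    have : {ω | ∀ t ≤ T, ‖y t ω‖ ≤ (n : ℝ)} = ⋂ t, ⋂ _ : t ≤ T, {ω | ‖y t ω‖ ≤ (n : ℝ)} := by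
      ext ω
      simp
    rw [this]
    exact MeasurableSet.iInter fun t => MeasurableSet.iInter fun _ =>
      measurableSet_le (hy t).norm measurable_const
  have hmono : Monotone fun n : ℕ => {ω | ∀ t ≤ T, ‖y t ω‖ ≤ (n : ℝ)} := fun n n' hn ω hω t ht =>
    (hω t ht).trans (by exact_mod_cast hn)
  have hun : ⋃ n : ℕ, {ω | ∀ t ≤ T, ‖y t ω‖ ≤ (n : ℝ)} = Set.univ := by
    refine Set.eq_univ_of_forall fun ω => Set.mem_iUnion.2 ?_
    obtain ⟨n, hn⟩ := exists_nat_ge (∑ t ∈ Finset.range (T + 1), ‖y t ω‖)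
    refine ⟨n, fun t ht => le_trans ?_ hn⟩
    exact Finset.single_le_sum (f := fun t => ‖y t ω‖) (fun _ _ => norm_nonneg _)
      (Finset.mem_range.2 (Nat.lt_succ_of_le ht))
  have h1 := tendsto_measure_iUnion_atTop (μ := P) hmono
  rw [hun, measure_univ] at h1
  have h2 := (ENNReal.tendsto_toReal ENNReal.one_ne_top).comp h1
  rw [ENNReal.toReal_one] at h2
  obtain ⟨n, hn⟩ := (h2.eventually_const_lt (by linarith : 1 - ε < 1)).exists
  exact ⟨n, hmeas n, hn⟩

end GridFilter

end Convergence

/-! ### Assembly: almost sure identities combined with the uniform estimates. -/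

theorem lemma6 {Ω : Type*} [MeasurableSpace Ω] {M N : ℕ} (a b : ℝ) (hab : a < b)
    (m : ℕ → (Fin M → ℝ) → EuclideanSpace ℝ (Fin N))
    (S : ℕ → (Fin M → ℝ) → Matrix (Fin N) (Fin N) ℝ) (σ : ℝ)
    (hobs : GridFilter.ObsAssumptions a b m S σ)
    (K : Kernel (Fin M → ℝ) (Fin M → ℝ)) [IsMarkovKernel K]
    (P : Measure Ω) [IsProbabilityMeasure P]
    (X : ℕ → Ω → Fin M → ℝ) (y : ℕ → Ω → EuclideanSpace ℝ (Fin N))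
    (hsys : GridFilter.IsPartiallyObserved a b m S σ K P X y)
    (I : (L : ℕ+) → Fin L → Set ℝ)
    (hI : ∀ L, GridFilter.IsUniformPartition a b L (I L))
    (hreg : GridFilter.ConditionallyRegular I K (P.map (X 0)))
    (T : ℕ)
    (Q : Measure Ω) [IsProbabilityMeasure Q]
    (hQ : GridFilter.IsReferenceMeasure T X y P Q)
    (C : ℝ) (hC : 1 ≤ C) :
    ∃ Ωhat : Set Ω, MeasurableSet Ωhat ∧
      1 - ((T : ℝ) + 1) ^ (1 - C * N) * Real.exp (-(C * N)) ≤ P.real Ωhat ∧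
      Tendsto (fun L : ℕ+ => GridFilter.uniformDist T Ωhat
        (GridFilter.approxFilter m S σ Q y (GridFilter.marginalQuantization a b (I L) X))
        (GridFilter.trueFilter P X y)) atTop (𝓝 0) ∧
      ∀ Z : (L : ℕ+) → ℕ → Ω → Fin M → Fin L,
        (∀ L, GridFilter.IsAuxiliaryChain T X y P Q (I L) (Z L)) →
        ∃ E : Set Ω, P E = 0 ∧
          Tendsto (fun L : ℕ+ => GridFilter.uniformDist T (Ωhat \ E)
            (GridFilter.approxFilter m S σ Q y (GridFilter.marginalQuantization a b (I L) X))
            (GridFilter.chainFilter a b m S σ Q y (Z L))) atTop (𝓝 0) ∧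
          Tendsto (fun L : ℕ+ => GridFilter.uniformDist T (Ωhat \ E)
            (GridFilter.chainFilter a b m S σ Q y (Z L))
            (GridFilter.trueFilter P X y)) atTop (𝓝 0) := by
  open GridFilter in
  have hX := hsys.measurable_state
  have hy := hsys.measurable_obs
  have hQt : ∀ t ≤ T, IsReferenceMeasure t X y P Q := fun t ht => hQ.mono hX ht
  have hξ := measurable_marginalQuantization hI hX
  -- The admissible exceptional probability is positive, which is all that the choice of `R`
  -- requires.
  obtain ⟨R, hRm, hR⟩ := exists_lt_measureReal_forall_norm_le (P := P) hy T
    (ε := ((T : ℝ) + 1) ^ (1 - C * N) * Real.exp (-(C * N))) (by positivity)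
  -- Times and levels are countable, so one null set serves all of them.
  have happ : ∀ᵐ ω ∂P, ∀ t, t ≤ T → ∀ L : ℕ+,
      approxFilter m S σ Q y (marginalQuantization a b (I L) X) t ω =
        pathPosterior a b m S σ t
          (Q.map (initialPath (t + 2) (marginalQuantization a b (I L) X)))
          (initialPath (t + 1) y ω) := by
    rw [ae_all_iff]
    intro t
    rw [eventually_imp_distrib_left]
    intro ht
    rw [ae_all_iff]
    intro L
    have hr : Measurable fun (x : Fin (t + 2) → Fin M → ℝ) k => quantizer a b (I L) (x k) :=
      measurable_pi_lambda _ fun k => (hI L).measurable_quantizer.comp (measurable_pi_apply k)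
    refine ae_eq_of_ae_eq_reference hobs hab.le hsys (hQt t ht) (measurable_approxFilter _ t)
      (hobs.measurable_pathPosterior_obs hab.le t _) ?_
    refine approxFilter_ae_eq_pathPosterior hobs hab.le hy (hξ L) (fun n hn => ?_)
      ((hQt t ht).indep.comp hr measurable_id)
    filter_upwards [hsys.ae_mem_pathBox_quantization hab.le hI (hQt t ht) L] with ω hω
    exact hω ⟨n, by omega⟩ trivial
  have htrue : ∀ᵐ ω ∂P, ∀ t, trueFilter P X y t ω =
      pathPosterior a b m S σ t (P.map (initialPath (t + 2) X)) (initialPath (t + 1) y ω) :=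
    ae_all_iff.2 fun t => trueFilter_ae_eq_pathPosterior hobs hab.le hsys t
  have hball : ∀ t ≤ T, ∀ ω, (∀ t ≤ T, ‖y t ω‖ ≤ R) →
      initialPath (t + 1) y ω ∈ Metric.closedBall 0 R := by
    intro t ht ω hω
    rw [mem_closedBall_zero_iff]
    exact (pi_norm_le_iff_of_nonempty _).2 fun k => hω k (by omega)
  have hnull := happ.and htrue
  rw [ae_iff] at hnull
  -- This null set does not depend on any chain, so it can be removed from the set of bounded
  -- observations; its measurable hull keeps the result measurable.
  set Nset := toMeasurable P {ω | ¬((∀ t, t ≤ T → ∀ L : ℕ+,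
      approxFilter m S σ Q y (marginalQuantization a b (I L) X) t ω =
        pathPosterior a b m S σ t
          (Q.map (initialPath (t + 2) (marginalQuantization a b (I L) X)))
          (initialPath (t + 1) y ω)) ∧ ∀ t, trueFilter P X y t ω =
      pathPosterior a b m S σ t (P.map (initialPath (t + 2) X)) (initialPath (t + 1) y ω))}
    with hNset
  have hN0 : P Nset = 0 := by rw [hNset, measure_toMeasurable, hnull]
  have hgood : ∀ ω, ω ∉ Nset → _ := fun ω hω => not_not.1 fun hbad =>
    hω (subset_toMeasurable P _ hbad)
  refine ⟨{ω | ∀ t ≤ T, ‖y t ω‖ ≤ R} \ Nset, hRm.diff (measurableSet_toMeasurable _ _), ?_,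
    tendsto_uniformDist fun t ht ε hε => ?_, fun Z hZ => ?_⟩
  · rw [measureReal_def, measure_sdiff_null hN0]
    exact hR.le
  · filter_upwards [hsys.eventually_norm_quantization_sub_le hobs hab.le hI (hQt t ht) R hε]
      with L hL ω hω
    obtain ⟨h1, h2⟩ := hgood ω hω.2
    rw [h1 t ht L, h2 t]
    exact hL _ (hball t ht ω hω.1)
  · have hZt : ∀ t ≤ T, ∀ L, IsAuxiliaryChain t X y P Q (I L) (Z L) := fun t ht L =>
      (hZ L).mono ht
    have hchain : ∀ᵐ ω ∂P, ∀ t, t ≤ T → ∀ L : ℕ+, chainFilter a b m S σ Q y (Z L) t ω =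
        pathPosterior a b m S σ t
          (Q.map (initialPath (t + 2) fun n ω i => recon M a b L i (Z L n ω)))
          (initialPath (t + 1) y ω) := by
      rw [ae_all_iff]
      intro t
      rw [eventually_imp_distrib_left]
      intro ht
      rw [ae_all_iff]
      intro L
      exact ae_eq_of_ae_eq_reference hobs hab.le hsys (hQt t ht) (measurable_chainFilter _ t)
        (hobs.measurable_pathPosterior_obs hab.le t _)
        (chainFilter_ae_eq_pathPosterior hobs hab.le hy (hZ L).measurable (hZt t ht L).indep)
    have hclose : ∀ t ≤ T, ∀ ε : ℝ, 0 < ε → _ := fun t ht ε hε =>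
      hsys.eventually_norm_chain_sub_le hobs hab.le hI hreg (hQt t ht) (hZt t ht) R hε
    -- The exceptional set `E` is where the chain identities fail, and thus depends on `Z`.
    refine ⟨_, ae_iff.1 hchain, tendsto_uniformDist fun t ht ε hε => ?_,
      tendsto_uniformDist fun t ht ε hε => ?_⟩
    · filter_upwards [hclose t ht ε hε] with L hL ω hω
      rw [(hgood ω hω.1.2).1 t ht L, not_not.1 hω.2 t ht L]
      exact hL _ (hball t ht ω hω.1.1)
    · filter_upwards [hclose t ht (ε / 2) (half_pos hε),
        hsys.eventually_norm_quantization_sub_le hobs hab.le hI (hQt t ht) R (half_pos hε)]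
        with L hL hL' ω hω
      rw [(hgood ω hω.1.2).2 t, not_not.1 hω.2 t ht L]
      have hv := hball t ht ω hω.1.1
      refine (norm_sub_le_norm_sub_add_norm_sub _ _ _).trans
        ((add_le_add ?_ (hL' _ hv)).trans (add_halves ε).le)
      rw [norm_sub_rev]
      exact hL _ hv
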